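/- **Theorem (the 2-variation operator is unbounded on $L^2$).** For a sequence $(a_N)_{N\ge 1}$ of complex numbers let $$\mathcal V^2(a_N) := \sup_{N_1<N_2<\cdots}\Big(\sum_{k\ge1}|a_{N_k}-a_{N_{k+1}}|^2\Big)^{1/2}\in[0,\infty],$$ the supremum being over all strictly increasing sequences of positive integers. (i) (Torus rotations.) Let $\mathbb T=\mathbb R/\mathbb Z$ with Lebesgue measure, and for $\alpha\in\mathbb T$ and $f:\mathbb T\to\mathbb C$ put $K_N^\alpha f(x):=\frac1N\sum_{n=1}^N f(x+n^2\alpha)$. For every $C>0$ and every sufficiently large integer $R\ge R_0(C)$ there is, with $\alpha=2^{-R}$, an $f\in L^2(\mathbb T)$ with $\|f\|_{L^2(\mathbb T)}=1$ and $$\|\mathcal V^2(K_N^{\alpha}f)\|_{L^2(\mathbb T)}\ge C.$$ (ii) (Aperiodic systems.) Let $(X,\Sigma,\mu)$ be a probability space and $\tau:X\to X$ an invertible bi-measurable measure-preserving transformation that is aperiodic: for every $n\ge1$, every $E\in\Sigma$ with $\mu(E)>0$ contains some $F\in\Sigma$ with $\mu(F\,\triangle\,\tau^{-n}F)>0$.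 (On a standard Borel space this says that $\mu$-almost no point is periodic under $\tau$.) Put $M_Nf(x):=\frac1N\sum_{n=1}^N \tau^{n^2}f(x)$, where $\tau^{m}f(x):=f(\tau^{-m}x)$. Then for every $C>0$ there is an $f\in L^2(X,\mu)$ with $\|f\|_{L^2(X)}=1$ and $$\|\mathcal V^2(M_Nf)\|_{L^2(X)}\ge C.$$ -/

import Mathlib

open MeasureTheory
open scoped ENNReal symmDiff

/-- The `r`-variation of a sequence indexed by the positive integers: the supremum, over all
strictly increasing sequences of indices, of the `ℓ^r`-norm of the successive differences.
It takes values in `[0, ∞]`. -/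
noncomputable def rVariation (r : ℝ) (a : ℕ+ → ℂ) : ℝ≥0∞ :=
  ⨆ (i : ℕ → ℕ+) (_ : StrictMono i), (∑' k, ‖a (i k) - a (i (k + 1))‖ₑ ^ r) ^ (1 / r)

/-- The average of `f` along the first `N` squares of the orbit of `x` under `S`:
`(1 / N) ∑_{1 ≤ n ≤ N} f (S^{n²} x)`. -/
noncomputable def squareMean {X : Type*} (S : X → X) (f : X → ℂ) (N : ℕ+) (x : X) : ℂ :=
  (1 / ((N : ℕ) : ℂ)) * ∑ n ∈ Finset.Icc 1 (N : ℕ), f (S^[n ^ 2] x)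

/-- Aperiodicity of a measure-preserving transformation of an arbitrary measure space: no positive
power `T^n` fixes, up to null sets, all measurable subsets of a measurable set of positive measure.
On spaces whose measurable sets are countably separated (in particular on standard Borel spaces)
this says that almost no point is periodic, see `isAperiodic_iff_ae_not_periodic`. -/
def IsAperiodic {X : Type*} [MeasurableSpace X] (T : X → X) (μ : Measure X) : Prop :=
  ∀ n : ℕ, 0 < n → ∀ E : Set X, MeasurableSet E → μ E ≠ 0 →
    ∃ F ⊆ E, MeasurableSet F ∧ μ (F ∆ (T^[n] ⁻¹' F)) ≠ 0

theorem isAperiodic_iff_ae_not_periodic {X : Type*} [MeasurableSpace X]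
    [MeasurableSpace.CountablySeparated X] (μ : Measure X) (T : X ≃ᵐ X) :
    IsAperiodic T μ ↔ ∀ n : ℕ, 0 < n → μ {x | T^[n] x = x} = 0 := by
  have hT : ∀ n, Measurable (T^[n]) := fun n => T.measurable.iterate n
  constructor
  · intro h n hn
    by_contra hE
    obtain ⟨g, hg, hginj⟩ := MeasurableSpace.measurable_injection_nat_bool_of_countablySeparated X
    have hm : MeasurableSet {x | T^[n] x = x} := by
      have : {x | T^[n] x = x} = ⋂ k, {x | g (T^[n] x) k = g x k} := by
        ext x
        simp only [Set.mem_ofPred_eq, Set.mem_iInter, ← funext_iff, hginj.eq_iff]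
      rw [this]
      exact MeasurableSet.iInter fun k => measurableSet_eq_fun
        ((measurable_pi_apply k).comp (hg.comp (hT n))) ((measurable_pi_apply k).comp hg)
    obtain ⟨F, hFE, -, hF⟩ := h n hn _ hm hE
    apply hF
    have : F = T^[n] ⁻¹' F := by
      ext x
      constructor
      · intro hx
        have : T^[n] x = x := hFE hx
        simpa [this] using hx
      · intro hx
        have h1 : T^[n] (T^[n] x) = T^[n] x := hFE hx
        have h2 : T^[n] x = x := (T.injective.iterate n) h1
        simpa [h2] using hx
    rw [← this]
    simp
  · intro h n hn E hE hE0
    by_contra! hcon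
    obtain ⟨S, hS, hSm, hsep⟩ := (MeasurableSpace.CountablySeparated.countably_separated (α := X)).1
    have key : ∀ F ⊆ E, MeasurableSet F → ∀ᵐ x ∂μ, x ∈ F ↔ T^[n] x ∈ F := by
      intro F hF hFm
      filter_upwards [measure_eq_zero_iff_ae_notMem.1 (hcon F hF hFm)] with x hx
      simp only [Set.mem_symmDiff, Set.mem_preimage] at hx
      tauto
    have h1 : ∀ᵐ x ∂μ, ∀ A ∈ S, x ∈ E ∩ A ↔ T^[n] x ∈ E ∩ A := by
      rw [ae_ball_iff hS]
      exact fun A hA => key _ Set.inter_subset_left (hE.inter (hSm A hA))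
    apply hE0
    rw [measure_eq_zero_iff_ae_notMem]
    filter_upwards [h1, key E le_rfl hE, measure_eq_zero_iff_ae_notMem.1 (h n hn)]
      with x hx1 hx2 hx3 hxE
    apply hx3
    have hTE := hx2.1 hxE
    refine (hsep x trivial (T^[n] x) trivial fun A hA => ?_).symm
    have := hx1 A hA
    simp only [Set.mem_inter_iff, hxE, hTE, true_and] at this
    exact this

/-! The mechanism is the failure of the variational estimate at exponent 2 for simple random walk:
for a walk of `K` steps, the mean of the squared 2-variation divided by `K` is unbounded, although
the mean square displacement is only `K`. Averages along squares can be made to follow such a walk.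

Random walk. `blockVar` is a recursive lower bound for the squared 2-variation on an interval of
length `m ^ n`. Passing to the next scale joins `m` independent copies, and with probability bounded
below in terms of `m` alone all of them drift upwards, so that the square of the total increment
beats the sum of the block variations. While the normalized mean stays below `C`, each scale adds a
fixed amount (`meanBlockVar_succ`), so it is unbounded (`exists_le_meanBlockVar`).

Realization. A square wave on the integers with half period `M` is almost unchanged by averaging
over `N` squares if `N ^ 2` is small against `M`, and almost annihilated if `N ^ 2` is large against
`M` and `N` is small against `M`. For a sum of `K` waves with widely separated half periods `2 ^ (2
* (d + 2 * h * k))`, the average at the `j`-th time therefore nearly equals the sum of the waves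
with `k ≥ j`, which is the whole sum minus the walk at time `j`. The signs are separate binary
digits of `x`, hence independent. This yields the periodic model `exists_periodic_blockVar`.

Transference. `exists_rVariation_ge_of_tower` copies the model to a tower of disjoint sets of equal
measure: the arcs of length `2 ^ (-R)` on the circle, or the iterated preimages of a suitable set in
an aperiodic system. The tower need not fill the space, because both sides of the inequality scale
with the measure of a floor. -/

/-! ### Block variation and its comparison with the 2-variation. -/

/-- A lower bound for the square of the `2`-variation of `a` on `[s, s + m ^ n]`: at each level of
the `m`-adic subdivision one takes the better of the subdivided block and the whole increment. -/
noncomputable def blockVar {E : Type*} [NormedAddCommGroup E] (m : ℕ) :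
    ℕ → (ℕ → E) → ℕ → ℝ
  | 0, a, s => ‖a s - a (s + 1)‖ ^ 2
  | n + 1, a, s => max (∑ i ∈ Finset.range m, blockVar m n a (s + m ^ n * i))
      (‖a s - a (s + m ^ (n + 1))‖ ^ 2)

section BlockVar

variable {E E' : Type*} [NormedAddCommGroup E] [NormedAddCommGroup E']

theorem blockVar_nonneg (m n : ℕ) (a : ℕ → E) (s : ℕ) : 0 ≤ blockVar m n a s := by
  cases n with
  | zero => exact sq_nonneg _
  | succ n => exact (sq_nonneg _).trans (le_max_right _ _)

/-- Only squared increments enter, and at most `m ^ n` of them are summed, so each may be perturbed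
by `δ`. -/
theorem blockVar_le_add {m : ℕ} (hm : 0 < m) {δ : ℝ} (hδ : 0 ≤ δ) (n : ℕ) (a : ℕ → E)
    (b : ℕ → E') (s t : ℕ)
    (h : ∀ i ≤ m ^ n, ∀ j ≤ m ^ n,
      ‖a (s + i) - a (s + j)‖ ^ 2 ≤ ‖b (t + i) - b (t + j)‖ ^ 2 + δ) :
    blockVar m n a s ≤ blockVar m n b t + (m : ℝ) ^ n * δ := by
  induction n generalizing s t with
  | zero => simpa [blockVar] using h 0 (by simp) 1 (by simp)
  | succ n ih =>
    have hle : ∀ i < m, m ^ n * i + m ^ n ≤ m ^ (n + 1) := fun i hi => by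
      rw [pow_succ, ← Nat.mul_succ]
      exact Nat.mul_le_mul_left _ hi
    rw [blockVar, blockVar]
    refine max_le ?_ ?_
    · have : ∑ i ∈ Finset.range m, blockVar m n a (s + m ^ n * i) ≤
          ∑ i ∈ Finset.range m, (blockVar m n b (t + m ^ n * i) + (m : ℝ) ^ n * δ) := by
        refine Finset.sum_le_sum fun i hi => ih _ _ fun p hp q hq => ?_
        have := hle i (Finset.mem_range.1 hi)
        simpa only [add_assoc] using
          h (m ^ n * i + p) (by omega) (m ^ n * i + q) (by omega)
      refine this.trans ?_
      rw [Finset.sum_add_distrib, Finset.sum_const, Finset.card_range, nsmul_eq_mul, ← mul_assoc,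
        ← pow_succ']
      gcongr
      exact le_max_left _ _
    · have h1 : (1 : ℝ) ≤ (m : ℝ) ^ (n + 1) := one_le_pow₀ (by exact_mod_cast hm)
      have := h 0 (by simp) (m ^ (n + 1)) le_rfl
      simp only [add_zero] at this
      refine this.trans (add_le_add (le_max_right _ _) ?_)
      exact le_mul_of_one_le_left hδ h1

theorem blockVar_congr {m : ℕ} (hm : 0 < m) (n : ℕ) (a : ℕ → E) (b : ℕ → E') (s t : ℕ)
    (h : ∀ i ≤ m ^ n, ∀ j ≤ m ^ n, ‖a (s + i) - a (s + j)‖ = ‖b (t + i) - b (t + j)‖) :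
    blockVar m n a s = blockVar m n b t := by
  apply le_antisymm
  · simpa using blockVar_le_add hm le_rfl n a b s t fun i hi j hj => by simp [h i hi j hj]
  · simpa using blockVar_le_add hm le_rfl n b a t s fun i hi j hj => by simp [h i hi j hj]

theorem blockVar_const_mul (m n : ℕ) (c : ℂ) (a : ℕ → ℂ) (s : ℕ) :
    blockVar m n (fun j => c * a j) s = ‖c‖ ^ 2 * blockVar m n a s := by
  induction n generalizing s with
  | zero => simp only [blockVar, ← mul_sub, norm_mul, mul_pow]
  | succ n ih =>
    simp only [blockVar, ih, ← mul_sub, norm_mul, mul_pow, ← Finset.mul_sum]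
    rw [mul_max_of_nonneg _ _ (sq_nonneg _)]

/-- `v` is the sum of the squared increments of `a` along a chain from `s` to `t`. -/
def IsChainSum (a : ℕ → E) (s t : ℕ) (v : ℝ) : Prop :=
  ∃ (L : ℕ) (i : ℕ → ℕ), StrictMono i ∧ i 0 = s ∧ i L = t ∧
    v = ∑ k ∈ Finset.range L, ‖a (i k) - a (i (k + 1))‖ ^ 2

theorem IsChainSum.refl (a : ℕ → E) (s : ℕ) : IsChainSum a s s 0 :=
  ⟨0, fun k => s + k, fun _ _ h => by simpa using h, by simp, by simp, by simp⟩

theorem IsChainSum.of_lt (a : ℕ → E) {s t : ℕ} (h : s < t) :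
    IsChainSum a s t (‖a s - a t‖ ^ 2) := by
  refine ⟨1, fun k => if k = 0 then s else t + (k - 1), strictMono_nat_of_lt_succ fun k => ?_,
    by simp, by simp, by simp⟩
  rcases k with _ | k
  · simpa using h
  · simp

theorem IsChainSum.trans {a : ℕ → E} {s t u : ℕ} {v w : ℝ} (h₁ : IsChainSum a s t v)
    (h₂ : IsChainSum a t u w) : IsChainSum a s u (v + w) := by
  obtain ⟨L₁, i₁, hi₁, h0₁, hL₁, rfl⟩ := h₁
  obtain ⟨L₂, i₂, hi₂, h0₂, hL₂, rfl⟩ := h₂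
  have hlt : ∀ k ≤ L₁, (if k < L₁ then i₁ k else i₂ (k - L₁)) = i₁ k := fun k hk => by
    rcases hk.lt_or_eq with hk | rfl
    · simp [hk]
    · simp [h0₂, hL₁]
  have hge : ∀ k, (if L₁ + k < L₁ then i₁ (L₁ + k) else i₂ (L₁ + k - L₁)) = i₂ k := fun k => by
    simp
  refine ⟨L₁ + L₂, fun k => if k < L₁ then i₁ k else i₂ (k - L₁),
    strictMono_nat_of_lt_succ fun k => ?_, ?_, ?_, ?_⟩
  · rcases lt_or_ge k L₁ with hk | hk
    · simp only [hlt k hk.le, hlt (k + 1) hk]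
      exact hi₁ k.lt_succ_self
    · obtain ⟨l, rfl⟩ := Nat.exists_eq_add_of_le hk
      simp only [add_assoc, hge]
      exact hi₂ l.lt_succ_self
  · exact (hlt 0 (Nat.zero_le _)).trans h0₁
  · simp only [hge, hL₂]
  · rw [Finset.sum_range_add]
    congr 1
    · refine Finset.sum_congr rfl fun k hk => ?_
      have hk := Finset.mem_range.1 hk
      simp only [hlt k hk.le, hlt (k + 1) hk]
    · refine Finset.sum_congr rfl fun k _ => ?_
      simp only [add_assoc, hge]

/-- Each maximum selects either the concatenated chains of the sub-blocks or the single long jump,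
so the recursive quantity is attained by an actual chain. -/
theorem isChainSum_blockVar {m : ℕ} (hm : 0 < m) (n : ℕ) (a : ℕ → E) (s : ℕ) :
    IsChainSum a s (s + m ^ n) (blockVar m n a s) := by
  induction n generalizing s with
  | zero => simpa [blockVar] using IsChainSum.of_lt a s.lt_succ_self
  | succ n ih =>
    have key : ∀ q, IsChainSum a s (s + m ^ n * q)
        (∑ i ∈ Finset.range q, blockVar m n a (s + m ^ n * i)) := by
      intro q
      induction q with
      | zero => simpa using IsChainSum.refl a s
      | succ q ihq =>
        rw [Finset.sum_range_succ, Nat.mul_succ, ← add_assoc]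
        exact ihq.trans (ih _)
    rw [blockVar]
    rcases max_choice (∑ i ∈ Finset.range m, blockVar m n a (s + m ^ n * i))
      (‖a s - a (s + m ^ (n + 1))‖ ^ 2) with h | h <;> rw [h]
    · exact key m
    · exact IsChainSum.of_lt a (Nat.lt_add_of_pos_right (pow_pos hm _))

end BlockVar

theorem ofReal_blockVar_le_rVariation_sq {m : ℕ} (hm : 0 < m) (n : ℕ) (a : ℕ+ → ℂ)
    {N : ℕ → ℕ+} (hN : StrictMono N) (s : ℕ) :
    ENNReal.ofReal (blockVar m n (fun j => a (N j)) s) ≤ rVariation 2 a ^ (2 : ℝ) := by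
  obtain ⟨L, i, hi, -, -, h⟩ := isChainSum_blockVar hm n (fun j => a (N j)) s
  have h1 : (∑' k, ‖a (N (i k)) - a (N (i (k + 1)))‖ₑ ^ (2 : ℝ)) ^ (1 / (2 : ℝ)) ≤
      rVariation 2 a :=
    le_iSup₂ (f := fun (i : ℕ → ℕ+) (_ : StrictMono i) =>
      (∑' k, ‖a (i k) - a (i (k + 1))‖ₑ ^ (2 : ℝ)) ^ (1 / (2 : ℝ))) (N ∘ i) (hN.comp hi)
  have h2 := ENNReal.rpow_le_rpow h1 (zero_le_two (α := ℝ))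
  rw [← ENNReal.rpow_mul, one_div, inv_mul_cancel₀ two_ne_zero, ENNReal.rpow_one] at h2
  refine le_trans ?_ h2
  rw [h, ENNReal.ofReal_sum_of_nonneg fun _ _ => sq_nonneg _]
  refine le_trans (Finset.sum_le_sum fun k _ => ?_) (ENNReal.sum_le_tsum (Finset.range L))
  rw [ENNReal.ofReal_pow (norm_nonneg _), ofReal_norm, ENNReal.rpow_two]

/-! ### Unbounded mean block variation of simple random walk. -/

/-- Block summation over independent copies: the maximum of a sum and a squared sum gains over the
sum on the event that all copies lie in `A`. -/
theorem card_pow_mul_sum_add_le_sum_max {Ω : Type*} [Fintype Ω] (m : ℕ)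
    (S W : Ω → ℝ) (A : Finset Ω) {e b : ℝ} (he : 0 ≤ e)
    (hS : ∀ ω ∈ A, e ≤ S ω) (hb : ∀ ω ∈ A, W ω ≤ b) :
    (m : ℝ) * ((Fintype.card Ω : ℝ) ^ (m - 1) * ∑ ω, W ω) +
        (A.card : ℝ) ^ m * ((m * e) ^ 2 - m * b) ≤
      ∑ ω : Fin m → Ω, max (∑ i, W (ω i)) ((∑ i, S (ω i)) ^ 2) := by
  classical
  have h1 : ∑ ω : Fin m → Ω, ∑ i, W (ω i) =
      (m : ℝ) * ((Fintype.card Ω : ℝ) ^ (m - 1) * ∑ ω, W ω) := by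
    rw [Finset.sum_comm]
    have : ∀ i : Fin m, ∑ ω : Fin m → Ω, W (ω i) =
        (Fintype.card Ω : ℝ) ^ (m - 1) * ∑ ω, W ω := fun i => by
      have := Fintype.sum_piFinset_apply (ι := Fin m) W Finset.univ i
      rw [Fintype.piFinset_univ] at this
      rw [this, nsmul_eq_mul, Finset.card_univ, Fintype.card_fin, Nat.cast_pow]
    simp [this]
  have h2 : ∑ ω : Fin m → Ω, (if ω ∈ Fintype.piFinset (fun _ : Fin m => A) then
      (m * e) ^ 2 - m * b else 0) = (A.card : ℝ) ^ m * ((m * e) ^ 2 - m * b) := by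
    rw [Finset.sum_ite_mem, Finset.univ_inter, Finset.sum_const, Fintype.card_piFinset_const,
      nsmul_eq_mul, Nat.cast_pow]
  rw [← h1, ← h2, ← Finset.sum_add_distrib]
  refine Finset.sum_le_sum fun ω _ => ?_
  split_ifs with h
  · rw [Fintype.mem_piFinset] at h
    refine le_max_of_le_right ?_
    have hs : m * e ≤ ∑ i, S (ω i) := by
      simpa using Finset.card_nsmul_le_sum Finset.univ (fun i => S (ω i)) e fun i _ => hS _ (h i)
    have hw : ∑ i, W (ω i) ≤ m * b := by
      simpa using Finset.sum_le_card_nsmul Finset.univ (fun i => W (ω i)) b fun i _ => hb _ (h i)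
    have := pow_le_pow_left₀ (by positivity) hs 2
    linarith
  · rw [add_zero]
    exact le_max_left _ _

/-- The `k`-th step of the walk with signs `(-1) ^ ω k`. -/
noncomputable def signStep {K : ℕ} (ω : Fin K → Fin 2) (k : ℕ) : ℝ :=
  if h : k < K then (-1) ^ (ω ⟨k, h⟩ : ℕ) else 0

/-- The position at time `j` of the walk with signs `(-1) ^ ω k`. -/
noncomputable def signWalk {K : ℕ} (ω : Fin K → Fin 2) (j : ℕ) : ℝ :=
  ∑ k ∈ Finset.range j, signStep ω k

theorem signWalk_last {K : ℕ} (ω : Fin K → Fin 2) :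
    signWalk ω K = ∑ k, (-1 : ℝ) ^ (ω k : ℕ) := by
  simp [signWalk, signStep, Finset.sum_range]

theorem signWalk_last_cons {K : ℕ} (b : Fin 2) (ω : Fin K → Fin 2) :
    signWalk (Fin.cons b ω : Fin (K + 1) → Fin 2) (K + 1) =
      (-1) ^ (b : ℕ) + signWalk ω K := by
  simp [signWalk_last, Fin.sum_univ_succ]

theorem sum_signWalk_last_succ (K : ℕ) (φ : ℝ → ℝ) :
    ∑ ω : Fin (K + 1) → Fin 2, φ (signWalk ω (K + 1)) =
      ∑ ω : Fin K → Fin 2, (φ (1 + signWalk ω K) + φ (-1 + signWalk ω K)) := by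
  rw [← (Fin.consEquiv fun _ : Fin (K + 1) => Fin 2).sum_comp, Fintype.sum_prod_type,
    Finset.sum_comm]
  refine Finset.sum_congr rfl fun ω _ => ?_
  have h : ∀ b : Fin 2, (Fin.consEquiv fun _ : Fin (K + 1) => Fin 2) (b, ω) = Fin.cons b ω :=
    fun _ => rfl
  simp [Fin.sum_univ_two, h, signWalk_last_cons]

theorem sum_signWalk_sq (K : ℕ) :
    ∑ ω : Fin K → Fin 2, signWalk ω K ^ 2 = K * 2 ^ K := by
  induction K with
  | zero => simp [signWalk]
  | succ K ih =>
    rw [sum_signWalk_last_succ K (fun s => s ^ 2)]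
    have : ∀ ω : Fin K → Fin 2, (1 + signWalk ω K) ^ 2 + (-1 + signWalk ω K) ^ 2 =
      2 * signWalk ω K ^ 2 + 2 := fun ω => by ring
    simp only [this, Finset.sum_add_distrib, ← Finset.mul_sum, ih]
    simp
    ring

theorem sum_signWalk_pow_four (K : ℕ) :
    ∑ ω : Fin K → Fin 2, signWalk ω K ^ 4 = (3 * (K : ℝ) ^ 2 - 2 * K) * 2 ^ K := by
  induction K with
  | zero => simp [signWalk]
  | succ K ih =>
    rw [sum_signWalk_last_succ K (fun s => s ^ 4)]
    have : ∀ ω : Fin K → Fin 2, (1 + signWalk ω K) ^ 4 + (-1 + signWalk ω K) ^ 4 =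
      2 * signWalk ω K ^ 4 + 12 * signWalk ω K ^ 2 + 2 := fun ω => by ring
    simp only [this, Finset.sum_add_distrib, ← Finset.mul_sum, ih, sum_signWalk_sq]
    simp
    ring

theorem signWalk_last_rev {K : ℕ} (ω : Fin K → Fin 2) :
    signWalk (fun k => (ω k).rev) K = - signWalk ω K := by
  rw [signWalk_last, signWalk_last, ← Finset.sum_neg_distrib]
  refine Finset.sum_congr rfl fun k _ => ?_
  generalize ω k = b
  fin_cases b <;> simp

/-- Paley–Zygmund: the second moment is `K` and the fourth at most `3 * K ^ 2`. The set in question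
carries at least half of the second moment, and Cauchy–Schwarz turns this into a lower bound for its
size. -/
theorem two_pow_le_card_signWalk_sq {K : ℕ} (hK : 0 < K) :
    (2 : ℝ) ^ K ≤ 12 * (Finset.univ.filter fun ω : Fin K → Fin 2 =>
      (K : ℝ) / 2 ≤ signWalk ω K ^ 2).card := by
  set A := Finset.univ.filter fun ω : Fin K → Fin 2 => (K : ℝ) / 2 ≤ signWalk ω K ^ 2 with hA
  have hK' : (0 : ℝ) < K := by exact_mod_cast hK
  have h2 : (0 : ℝ) < 2 ^ K := by positivity
  have hsplit := Finset.sum_filter_add_sum_filter_not (Finset.univ : Finset (Fin K → Fin 2))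
    (fun ω => (K : ℝ) / 2 ≤ signWalk ω K ^ 2) (fun ω => signWalk ω K ^ 2)
  rw [sum_signWalk_sq, ← hA] at hsplit
  have hsmall : ∑ ω ∈ Finset.univ.filter (fun ω : Fin K → Fin 2 =>
      ¬ (K : ℝ) / 2 ≤ signWalk ω K ^ 2), signWalk ω K ^ 2 ≤ 2 ^ K * (K / 2) := by
    refine (Finset.sum_le_card_nsmul _ _ ((K : ℝ) / 2) fun ω hω => ?_).trans ?_
    · exact (not_le.1 (Finset.mem_filter.1 hω).2).le
    · rw [nsmul_eq_mul]
      gcongr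
      have := Finset.card_filter_le (Finset.univ : Finset (Fin K → Fin 2))
        (fun ω => ¬ (K : ℝ) / 2 ≤ signWalk ω K ^ 2)
      rw [Finset.card_univ, Fintype.card_fun, Fintype.card_fin, Fintype.card_fin] at this
      exact_mod_cast this
  have hcs := Finset.sum_mul_sq_le_sq_mul_sq A (fun _ => (1 : ℝ)) (fun ω => signWalk ω K ^ 2)
  simp only [one_mul, one_pow, Finset.sum_const, nsmul_eq_mul, mul_one, ← pow_mul] at hcs
  have h4 : ∑ ω ∈ A, signWalk ω K ^ (2 * 2) ≤ 3 * (K : ℝ) ^ 2 * 2 ^ K := by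
    refine (Finset.sum_le_univ_sum_of_nonneg fun ω => Even.pow_nonneg (by decide) _).trans ?_
    rw [sum_signWalk_pow_four]
    gcongr
    linarith
  have hlow : (K : ℝ) * 2 ^ K / 2 ≤ ∑ ω ∈ A, signWalk ω K ^ 2 := by linarith
  have h5 := pow_le_pow_left₀ (by positivity) hlow 2
  have h6 : ((K : ℝ) * 2 ^ K / 2) ^ 2 ≤ A.card * (3 * (K : ℝ) ^ 2 * 2 ^ K) :=
    h5.trans (hcs.trans (by gcongr))
  have h7 : ((K : ℝ) ^ 2 * 2 ^ K / 4) * 2 ^ K ≤ ((K : ℝ) ^ 2 * 2 ^ K / 4) * (12 * A.card) := by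
    linarith
  exact le_of_mul_le_mul_left h7 (by positivity)

/-- Flipping all signs exchanges the two tails, which costs a factor 2. One-sidedness matters:
increments of the same sign add up without cancellation. -/
theorem two_pow_le_card_signWalk {K : ℕ} (hK : 0 < K) :
    (2 : ℝ) ^ K ≤ 24 * (Finset.univ.filter fun ω : Fin K → Fin 2 =>
      √((K : ℝ) / 2) ≤ signWalk ω K).card := by
  classical
  refine (two_pow_le_card_signWalk_sq hK).trans ?_
  set A := Finset.univ.filter fun ω : Fin K → Fin 2 => √((K : ℝ) / 2) ≤ signWalk ω K with hA
  have hsub : (Finset.univ.filter fun ω : Fin K → Fin 2 => (K : ℝ) / 2 ≤ signWalk ω K ^ 2) ⊆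
      A ∪ A.image fun ω k => (ω k).rev := by
    intro ω hω
    have hω := Real.sqrt_le_sqrt (Finset.mem_filter.1 hω).2
    rw [Real.sqrt_sq_eq_abs, le_abs] at hω
    rw [Finset.mem_union, Finset.mem_image]
    refine hω.imp (fun h => by simpa [hA] using h) fun h => ⟨fun k => (ω k).rev, ?_, ?_⟩
    · simpa [hA, signWalk_last_rev] using h
    · simp
  have := (Finset.card_le_card hsub).trans (Finset.card_union_le _ _)
  have h2 : (A.image fun ω k => (ω k).rev).card ≤ A.card := Finset.card_image_le
  have h3 : ((Finset.univ.filter fun ω : Fin K → Fin 2 =>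
      (K : ℝ) / 2 ≤ signWalk ω K ^ 2).card : ℝ) ≤ 2 * A.card := by
    exact_mod_cast (by omega)
  linarith

theorem signStep_block {m K : ℕ} (ω : Fin m → Fin K → Fin 2) (i : Fin m) {k : ℕ} (hk : k < K) :
    signStep (fun p => ω (finProdFinEquiv.symm p).1 (finProdFinEquiv.symm p).2) (K * i + k) =
      signStep (ω i) k := by
  have h : (⟨K * i + k, by nlinarith [i.2]⟩ : Fin (m * K)) = finProdFinEquiv (i, ⟨k, hk⟩) := by
    ext
    simp [finProdFinEquiv, add_comm]
  have hlt : K * (i : ℕ) + k < m * K := by nlinarith [i.2]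
  rw [signStep, signStep, dif_pos hlt, dif_pos hk, h, Equiv.symm_apply_apply]

/-- Self-similarity: a walk of `m * m ^ n` steps is `m` independent walks of `m ^ n` steps laid end
to end, and the block variation does not see their starting heights. -/
theorem blockVar_signWalk_block {m n : ℕ} (hm : 0 < m) (ω : Fin m → Fin (m ^ n) → Fin 2) :
    blockVar m (n + 1)
        (signWalk fun p => ω (finProdFinEquiv.symm p).1 (finProdFinEquiv.symm p).2) 0 =
      max (∑ i, blockVar m n (signWalk (ω i)) 0) ((∑ i, signWalk (ω i) (m ^ n)) ^ 2) := by
  rw [blockVar]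
  congr 1
  · rw [Finset.sum_range]
    refine Finset.sum_congr rfl fun i _ => blockVar_congr hm _ _ _ _ _ fun p hp q hq => ?_
    have key : ∀ p ≤ m ^ n,
        signWalk (fun p => ω (finProdFinEquiv.symm p).1 (finProdFinEquiv.symm p).2)
          (0 + m ^ n * i + p) =
        signWalk (fun p => ω (finProdFinEquiv.symm p).1 (finProdFinEquiv.symm p).2) (m ^ n * i) +
          signWalk (ω i) (0 + p) := fun p hp => by
      rw [zero_add, zero_add, signWalk, Finset.sum_range_add]
      congr 1
      exact Finset.sum_congr rfl fun k hk =>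
        signStep_block ω i ((Finset.mem_range.1 hk).trans_le hp)
    rw [key p hp, key q hq, add_sub_add_left_eq_sub]
  · have h : signWalk (fun p => ω (finProdFinEquiv.symm p).1 (finProdFinEquiv.symm p).2)
        (m * m ^ n) = ∑ i, signWalk (ω i) (m ^ n) := by
      simp only [signWalk_last]
      rw [← finProdFinEquiv.sum_comp, Fintype.sum_prod_type]
      simp
    have h0 : signWalk (fun p => ω (finProdFinEquiv.symm p).1 (finProdFinEquiv.symm p).2) 0 = 0 := by
      simp [signWalk]
    rw [h0, ← h, zero_add, zero_sub, norm_neg, Real.norm_eq_abs, sq_abs]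
    exact congrArg
      (fun t => signWalk (fun p => ω (finProdFinEquiv.symm p).1 (finProdFinEquiv.symm p).2) t ^ 2)
      (pow_succ' m n)

theorem sum_blockVar_signWalk_succ {m : ℕ} (hm : 0 < m) (n : ℕ) :
    ∑ ω : Fin (m ^ (n + 1)) → Fin 2, blockVar m (n + 1) (signWalk ω) 0 =
      ∑ ω : Fin m → Fin (m ^ n) → Fin 2,
        max (∑ i, blockVar m n (signWalk (ω i)) 0) ((∑ i, signWalk (ω i) (m ^ n)) ^ 2) := by
  simp only [← blockVar_signWalk_block hm]
  rw [pow_succ']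
  let e : (Fin m → Fin (m ^ n) → Fin 2) ≃ (Fin (m * m ^ n) → Fin 2) :=
    (Equiv.curry _ _ _).symm.trans (finProdFinEquiv.arrowCongr (Equiv.refl _))
  exact (e.sum_comp fun ω => blockVar m (n + 1) (signWalk ω) 0).symm

/-- The mean of `blockVar` along the walk, divided by the number of steps. -/
noncomputable def meanBlockVar (m n : ℕ) : ℝ :=
  (∑ ω : Fin (m ^ n) → Fin 2, blockVar m n (signWalk ω) 0) / (m ^ n * 2 ^ m ^ n)

/-- At least a proportion `1 / 48` of the walks both rise by `√(K / 2)` and have block variation at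
most `48 * C * K`. When all `m` copies are of this kind, the single jump contributes at least `m ^ 2
* K / 2`, against at most `48 * C * m * K` for the subdivision. The condition `192 * C ≤ m` makes
the former at least twice the latter. -/
theorem meanBlockVar_succ {m : ℕ} {C : ℝ} (hC : 0 < C) (hm : 192 * C ≤ m) (n : ℕ)
    (h : meanBlockVar m n ≤ C) :
    meanBlockVar m n + 48 * C / 48 ^ m ≤ meanBlockVar m (n + 1) := by
  have hm0' : (0 : ℝ) < m := by linarith
  have hm0 : 0 < m := by exact_mod_cast hm0'
  obtain ⟨K, hK⟩ : ∃ K, K = m ^ n := ⟨_, rfl⟩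
  have hK0 : 0 < K := hK ▸ pow_pos hm0 n
  have hK0' : (0 : ℝ) < K := by exact_mod_cast hK0
  have hKc : (K : ℝ) = (m : ℝ) ^ n := by rw [hK]; push_cast; rfl
  set W : (Fin (m ^ n) → Fin 2) → ℝ := fun ω => blockVar m n (signWalk ω) 0 with hW
  set S : (Fin (m ^ n) → Fin 2) → ℝ := fun ω => signWalk ω (m ^ n) with hS
  set A := (Finset.univ.filter fun ω => √((K : ℝ) / 2) ≤ S ω ∧ W ω ≤ 48 * C * K) with hA
  have hmean : ∑ ω, W ω = meanBlockVar m n * (K * 2 ^ K) := by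
    rw [meanBlockVar, hK]
    push_cast
    rw [div_mul_cancel₀ _ (by positivity)]
  have hcard : (2 : ℝ) ^ K ≤ 48 * A.card := by
    have h1 : (2 : ℝ) ^ K ≤ 24 * (Finset.univ.filter fun ω => √((K : ℝ) / 2) ≤ S ω).card := by
      rw [hK]
      exact two_pow_le_card_signWalk (pow_pos hm0 n)
    -- Markov's inequality: large block variation excludes at most a proportion `1 / 48`, which
    -- leaves `1 / 24 - 1 / 48`.
    set B := Finset.univ.filter fun ω => 48 * C * K ≤ W ω with hB
    have hB1 : (B.card : ℝ) * (48 * C * K) ≤ C * (K * 2 ^ K) := by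
      rw [← nsmul_eq_mul]
      refine (Finset.card_nsmul_le_sum B W _ fun ω hω => (Finset.mem_filter.1 hω).2).trans ?_
      refine (Finset.sum_le_univ_sum_of_nonneg fun ω => blockVar_nonneg _ _ _ _).trans ?_
      rw [hmean]
      gcongr
    have hB2 : 48 * (B.card : ℝ) ≤ 2 ^ K := by
      refine le_of_mul_le_mul_left (a := C * K) ?_ (by positivity)
      linarith
    have hsub : (Finset.univ.filter fun ω => √((K : ℝ) / 2) ≤ S ω) ⊆ A ∪ B := by
      intro ω hω
      have hω := (Finset.mem_filter.1 hω).2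
      rw [Finset.mem_union, hA, hB, Finset.mem_filter, Finset.mem_filter]
      rcases le_total (W ω) (48 * C * K) with h | h
      · exact Or.inl ⟨Finset.mem_univ _, hω, h⟩
      · exact Or.inr ⟨Finset.mem_univ _, h⟩
    have h2 : ((Finset.univ.filter fun ω => √((K : ℝ) / 2) ≤ S ω).card : ℝ) ≤
        A.card + B.card := by
      exact_mod_cast (Finset.card_le_card hsub).trans (Finset.card_union_le _ _)
    linarith
  have key := card_pow_mul_sum_add_le_sum_max m S W A (e := √((K : ℝ) / 2)) (b := 48 * C * K)
    (Real.sqrt_nonneg _) (fun ω hω => (Finset.mem_filter.1 hω).2.1)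
    (fun ω hω => (Finset.mem_filter.1 hω).2.2)
  have hΩ : ((2 ^ m ^ n : ℕ) : ℝ) = 2 ^ K := by rw [hK]; push_cast; rfl
  rw [← sum_blockVar_signWalk_succ hm0, hmean, mul_pow,
    Real.sq_sqrt (by positivity), Fintype.card_fun, Fintype.card_fin, Fintype.card_fin,
    hΩ] at key
  have hpow : ((2 : ℝ) ^ K) ^ (m - 1) * 2 ^ K = (2 ^ K) ^ m := by
    rw [← pow_succ, Nat.sub_add_cancel hm0]
  have hA1 : ((2 : ℝ) ^ K) ^ m / 48 ^ m ≤ (A.card : ℝ) ^ m := by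
    rw [← div_pow]
    refine pow_le_pow_left₀ (by positivity) ?_ m
    linarith
  have hgain : 48 * C * (m * K) ≤ (m : ℝ) ^ 2 * (K / 2) - m * (48 * C * K) := by
    have := mul_le_mul_of_nonneg_right hm (by positivity : 0 ≤ (m : ℝ) * K / 2)
    linarith
  have hmul := mul_le_mul hA1 hgain (by positivity) (by positivity)
  have hexp : (2 : ℝ) ^ m ^ (n + 1) = (2 ^ K) ^ m := by rw [← pow_mul, hK, pow_succ]
  rw [meanBlockVar.eq_1 m (n + 1), le_div_iff₀ (by positivity), hexp, pow_succ, ← hKc]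
  refine le_trans (le_of_eq ?_) ((add_le_add_right hmul _).trans key)
  rw [← hpow]
  ring

/-- If the mean stayed below the bound for every `m` and `n`, then for one fixed large `m` the
constant gain per scale would make it grow linearly in `n`. -/
theorem exists_le_meanBlockVar (C : ℝ) : ∃ m n : ℕ, 0 < m ∧ C ≤ meanBlockVar m n := by
  by_contra! hcon
  obtain ⟨m, hm⟩ := exists_nat_ge (192 * max C 1)
  have hC : 0 < max C 1 := lt_max_of_lt_right one_pos
  have hm0' : (0 : ℝ) < m := by linarith
  have hm0 : 0 < m := by exact_mod_cast hm0'
  have hg : 0 < 48 * max C 1 / 48 ^ m := by positivity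
  have key : ∀ n : ℕ, n * (48 * max C 1 / 48 ^ m) ≤ meanBlockVar m n := by
    intro n
    induction n with
    | zero =>
      rw [Nat.cast_zero, zero_mul]
      exact div_nonneg (Finset.sum_nonneg fun _ _ => blockVar_nonneg _ _ _ _) (by positivity)
    | succ n ih =>
      have := meanBlockVar_succ hC hm n ((hcon m n hm0).le.trans (le_max_left _ _))
      push_cast
      linarith
  obtain ⟨n, hn⟩ := exists_nat_ge (max C 1 / (48 * max C 1 / 48 ^ m))
  rw [div_le_iff₀ hg] at hn
  exact absurd ((le_max_left C 1).trans (hn.trans (key n))) (not_le.2 (hcon m n hm0))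

/-! ### Averages of a square wave along squares. -/

/-- Leibniz criterion with unit slack. Peeling off the first term reverses the sign of the rest, so
the two bounds are proved together. -/
theorem alternating_sum_bounds (I : ℕ) (c : ℕ → ℤ) (h0 : ∀ i, 0 ≤ c i)
    (h1 : ∀ i, c (i + 1) ≤ c i + 1) :
    -(I : ℤ) ≤ ∑ i ∈ Finset.range I, (-1) ^ i * c i ∧
      ∑ i ∈ Finset.range I, (-1) ^ i * c i ≤ c 0 + I := by
  induction I generalizing c with
  | zero => simpa using h0 0
  | succ I ih =>
    have h := ih (fun i => c (i + 1)) (fun i => h0 _) (fun i => h1 _)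
    have hs : ∑ i ∈ Finset.range (I + 1), (-1) ^ i * c i =
        c 0 - ∑ i ∈ Finset.range I, (-1) ^ i * c (i + 1) := by
      rw [Finset.sum_range_succ', pow_zero, one_mul, sub_eq_add_neg, add_comm,
        ← Finset.sum_neg_distrib]
      congr 1
      exact Finset.sum_congr rfl fun i _ => by ring
    have := h1 0
    have := h0 0
    rw [hs]
    push_cast
    constructor <;> linarith [h.1, h.2]

theorem card_sq_div_lt {M x : ℕ} (hM : 0 < M) (N i : ℕ) :
    ((Finset.Icc 1 N).filter fun n => (x + n ^ 2) / M < i).card =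
      min N (Nat.sqrt (i * M - 1 - x)) := by
  have : ((Finset.Icc 1 N).filter fun n => (x + n ^ 2) / M < i) =
      Finset.Icc 1 (min N (Nat.sqrt (i * M - 1 - x))) := by
    ext n
    rw [Finset.mem_filter, Finset.mem_Icc, Finset.mem_Icc, Nat.div_lt_iff_lt_mul hM, le_min_iff,
      Nat.le_sqrt, sq]
    constructor
    · rintro ⟨⟨h1, h2⟩, h3⟩
      exact ⟨h1, h2, by omega⟩
    · rintro ⟨h1, h2, h3⟩
      have : 1 ≤ n * n := Nat.mul_le_mul h1 h1
      exact ⟨⟨h1, h2⟩, by omega⟩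
  rw [this, Nat.card_Icc, Nat.add_sub_cancel]

/-- Concavity of the square root, up to rounding. -/
theorem Nat.sqrt_add_sqrt_le (u M : ℕ) :
    Nat.sqrt (u + 2 * M) + Nat.sqrt u ≤ 2 * Nat.sqrt (u + M) + 1 := by
  have h1 := Nat.sqrt_le' (u + 2 * M)
  have h2 := Nat.sqrt_le' u
  have h3 := Nat.lt_succ_sqrt' (u + M)
  rw [Nat.succ_eq_add_one] at h3
  by_contra! h
  have h4 := Nat.pow_le_pow_left h 2
  zify at *
  nlinarith [sq_nonneg ((Nat.sqrt (u + 2 * M) : ℤ) - Nat.sqrt u)]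

/-- Grouping `n` by the half period containing `x + n ^ 2` gives an alternating sum of the counts `c
i`. By concavity of the square root these counts are decreasing up to an error 1, so the sum is
controlled by its first terms plus the number of half periods. -/
theorem abs_sum_neg_one_pow_sq_div_le_of_lt {M x : ℕ} (hM : 0 < M) (hx : x < M) (N : ℕ) :
    |∑ n ∈ Finset.Icc 1 N, (-1 : ℤ) ^ ((x + n ^ 2) / M)| ≤
      Nat.sqrt (2 * M) + (N ^ 2 / M : ℕ) + 1 := by
  set g : ℕ → ℕ := fun i => min N (Nat.sqrt (i * M - 1 - x)) with hg
  set c : ℕ → ℤ := fun i => (((Finset.Icc 1 N).filter fun n => (x + n ^ 2) / M = i).card : ℤ)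
    with hc
  have hcg : ∀ i, (g (i + 1) : ℤ) = g i + c i := by
    intro i
    simp only [hg, hc, ← card_sq_div_lt hM]
    rw [← Nat.cast_add, ← Finset.card_union_of_disjoint, ← Finset.filter_or]
    · simp only [Nat.lt_succ_iff_lt_or_eq]
    · exact Finset.disjoint_filter.2 fun n _ h => h.ne
  have hg0 : g 0 = 0 := by simp [hg]
  -- Concavity starts at `g 1`, since the subtraction in `g 0` is truncated. The count `c 0`, from a
  -- possibly incomplete half period, is therefore split off below.
  have hconc : ∀ i, g (i + 3) + g (i + 1) ≤ 2 * g (i + 2) + 1 := by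
    intro i
    simp only [hg]
    obtain ⟨u, hu⟩ : ∃ u, (i + 1) * M = u + 1 + x := by
      refine ⟨(i + 1) * M - 1 - x, ?_⟩
      have : M ≤ (i + 1) * M := Nat.le_mul_of_pos_left _ i.succ_pos
      omega
    have e1 : (i + 1) * M - 1 - x = u := by omega
    have e2 : (i + 2) * M - 1 - x = u + M := by
      have : (i + 2) * M = (i + 1) * M + M := by ring
      omega
    have e3 : (i + 3) * M - 1 - x = u + 2 * M := by
      have : (i + 3) * M = (i + 1) * M + 2 * M := by ring
      omega
    rw [e1, e2, e3]
    have := Nat.sqrt_add_sqrt_le u M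
    omega
  have hsum : ∑ n ∈ Finset.Icc 1 N, (-1 : ℤ) ^ ((x + n ^ 2) / M) =
      ∑ i ∈ Finset.range (N ^ 2 / M + 1 + 1), (-1) ^ i * c i := by
    rw [← Finset.sum_fiberwise_of_maps_to (t := Finset.range (N ^ 2 / M + 1 + 1))
      (g := fun n => (x + n ^ 2) / M)]
    · refine Finset.sum_congr rfl fun i _ => ?_
      rw [Finset.sum_congr rfl fun n hn => by rw [(Finset.mem_filter.1 hn).2], Finset.sum_const,
        nsmul_eq_mul, mul_comm]
    · intro n hn
      rw [Finset.mem_range, Nat.lt_succ_iff, ← Nat.add_div_right _ hM]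
      refine Nat.div_le_div_right ?_
      have := Nat.pow_le_pow_left (Finset.mem_Icc.1 hn).2 2
      omega
  have hb := alternating_sum_bounds (N ^ 2 / M + 1) (fun i => c (i + 1)) (fun i => by positivity)
    (fun i => by
      have h1 := hcg (i + 1)
      have h2 := hcg (i + 2)
      have h3 := hconc i
      zify at h3
      simp only [add_assoc] at *
      norm_num at *
      linarith)
  have hs : ∑ i ∈ Finset.range (N ^ 2 / M + 1 + 1), (-1) ^ i * c i =
      c 0 - ∑ i ∈ Finset.range (N ^ 2 / M + 1), (-1) ^ i * c (i + 1) := by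
    rw [Finset.sum_range_succ', pow_zero, one_mul, sub_eq_add_neg, add_comm,
      ← Finset.sum_neg_distrib]
    congr 1
    exact Finset.sum_congr rfl fun i _ => by ring
  have hc0 : 0 ≤ c 0 := by positivity
  have hc1 : 0 ≤ c 1 := by positivity
  have h01 : c 0 + c 1 ≤ Nat.sqrt (2 * M) := by
    have h1 := hcg 0
    have h2 := hcg 1
    rw [hg0] at h1
    have h3 : g 2 ≤ Nat.sqrt (2 * M) := (min_le_right _ _).trans (Nat.sqrt_le_sqrt (by omega))
    zify at h3
    norm_num at *
    linarith
  rw [hsum, hs, abs_le]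
  push_cast at *
  norm_num at hb
  constructor <;> linarith [hb.1, hb.2]

/-- Shifting `x` by multiples of `M` changes only a global sign. -/
theorem abs_sum_neg_one_pow_sq_div_le {M : ℕ} (hM : 0 < M) (x N : ℕ) :
    |∑ n ∈ Finset.Icc 1 N, (-1 : ℤ) ^ ((x + n ^ 2) / M)| ≤
      Nat.sqrt (2 * M) + (N ^ 2 / M : ℕ) + 1 := by
  refine le_trans (le_of_eq ?_) (abs_sum_neg_one_pow_sq_div_le_of_lt hM (Nat.mod_lt x hM) N)
  have : ∀ n, (-1 : ℤ) ^ ((x + n ^ 2) / M) =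
      (-1) ^ (x / M) * (-1) ^ ((x % M + n ^ 2) / M) := fun n => by
    rw [← pow_add]
    congr 1
    conv_lhs => rw [← Nat.div_add_mod x M, add_assoc, Nat.mul_add_div hM]
  simp only [this]
  rw [← Finset.mul_sum, abs_mul, abs_pow, abs_neg, abs_one, one_pow, one_mul]

/-- Averages of a square wave along squares are small if the wave length is small against the
square of the number of terms, and large against the number of terms. -/
theorem norm_mean_neg_one_pow_sq_div_le {u v h : ℕ} (h1 : u + h ≤ v) (h2 : v + h ≤ 2 * u) (x : ℕ) :
    ‖(1 / ((2 ^ v : ℕ) : ℂ)) * ∑ n ∈ Finset.Icc 1 (2 ^ v), (-1 : ℂ) ^ ((x + n ^ 2) / 2 ^ (2 * u))‖ ≤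
      4 / 2 ^ h := by
  have hb := abs_sum_neg_one_pow_sq_div_le (M := 2 ^ (2 * u)) (by positivity) x (2 ^ v)
  have hsq : Nat.sqrt (2 * 2 ^ (2 * u)) ≤ 2 * 2 ^ u := by
    refine (Nat.sqrt_lt'.2 ?_).le
    rw [pow_mul']
    nlinarith [(by positivity : 0 < 2 ^ u)]
  have hdiv : (2 ^ v) ^ 2 / 2 ^ (2 * u) = 2 ^ (2 * v - 2 * u) := by
    rw [← pow_mul, mul_comm v, Nat.pow_div (by omega) two_pos]
  have hcast : ‖∑ n ∈ Finset.Icc 1 (2 ^ v), (-1 : ℂ) ^ ((x + n ^ 2) / 2 ^ (2 * u))‖ =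
      ((|∑ n ∈ Finset.Icc 1 (2 ^ v), (-1 : ℤ) ^ ((x + n ^ 2) / 2 ^ (2 * u))| : ℤ) : ℝ) := by
    rw [Int.cast_abs, ← Complex.norm_intCast]
    push_cast
    rfl
  have hmain : (Nat.sqrt (2 * 2 ^ (2 * u)) + (2 ^ v) ^ 2 / 2 ^ (2 * u) + 1) * 2 ^ h ≤
      4 * 2 ^ v := by
    have e1 : 2 ^ u * 2 ^ h ≤ 2 ^ v := by
      rw [← pow_add]
      exact Nat.pow_le_pow_right two_pos h1
    have e2 : 2 ^ (2 * v - 2 * u) * 2 ^ h ≤ 2 ^ v := by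
      rw [← pow_add]
      exact Nat.pow_le_pow_right two_pos (by omega)
    have e3 : 2 ^ h ≤ 2 ^ v := Nat.pow_le_pow_right two_pos (by omega)
    have e4 := Nat.mul_le_mul_right (2 ^ h) hsq
    rw [hdiv]
    linarith
  rw [norm_mul, hcast, norm_div, norm_one, Complex.norm_natCast, one_div, inv_mul_eq_div,
    div_le_div_iff₀ (by positivity) (by positivity)]
  have hb' := (Int.cast_le (R := ℝ)).2 hb
  have hmain' := (Nat.cast_le (α := ℝ)).2 hmain
  push_cast at hb' hmain' ⊢
  exact (mul_le_mul_of_nonneg_right hb' (by positivity)).trans hmain'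

/-! ### Superposition of separated square waves. -/

/-- The sum of `K` square waves whose half periods are powers of two with exponents `2 d + 4 h k`. -/
noncomputable def waveSum (d h K x : ℕ) : ℂ :=
  ∑ k ∈ Finset.range K, (-1) ^ (x / 2 ^ (2 * (d + 2 * h * k)))

/-- The size of `N` lies a factor `2 ^ h` below the square root of the `j`-th half period and a
factor `2 ^ h` above that of the preceding one. The last hypothesis says that the squares do not
carry `x` across a jump of wave `j`. -/
theorem norm_squareMean_waveSum_sub_le {d h K j x : ℕ} (hd : 2 * h * K ≤ d) (hj : j ≤ K)
    {N : ℕ+} (hN : (N : ℕ) = 2 ^ (d + 2 * h * j - h))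
    (hx : x % 2 ^ (2 * (d + 2 * h * j)) + (N : ℕ) ^ 2 < 2 ^ (2 * (d + 2 * h * j))) :
    ‖squareMean Nat.succ (waveSum d h K) N x -
      ∑ k ∈ Finset.Ico j K, (-1) ^ (x / 2 ^ (2 * (d + 2 * h * k)))‖ ≤ K * (4 / 2 ^ h) := by
  have hmean : squareMean Nat.succ (waveSum d h K) N x = ∑ k ∈ Finset.range K,
      (1 / ((N : ℕ) : ℂ)) * ∑ n ∈ Finset.Icc 1 (N : ℕ),
        (-1 : ℂ) ^ ((x + n ^ 2) / 2 ^ (2 * (d + 2 * h * k))) := by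
    simp only [squareMean, waveSum, Nat.succ_iterate]
    rw [Finset.sum_comm, Finset.mul_sum]
  have hlarge : ∀ k ∈ Finset.Ico j K, (1 / ((N : ℕ) : ℂ)) * ∑ n ∈ Finset.Icc 1 (N : ℕ),
      (-1 : ℂ) ^ ((x + n ^ 2) / 2 ^ (2 * (d + 2 * h * k))) =
        (-1) ^ (x / 2 ^ (2 * (d + 2 * h * k))) := by
    intro k hk
    -- The half periods divide one another, so a point that crosses no jump of wave `j` crosses none
    -- of any slower wave.
    have hpow : 2 ^ (2 * (d + 2 * h * k)) =
        2 ^ (2 * (d + 2 * h * j)) * 2 ^ (4 * h * (k - j)) := by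
      rw [← pow_add]
      congr 1
      obtain ⟨l, rfl⟩ := Nat.exists_eq_add_of_le (Finset.mem_Ico.1 hk).1
      rw [Nat.add_sub_cancel_left]
      ring
    have hdiv : ∀ n ∈ Finset.Icc 1 (N : ℕ), (-1 : ℂ) ^ ((x + n ^ 2) / 2 ^ (2 * (d + 2 * h * k))) =
        (-1) ^ (x / 2 ^ (2 * (d + 2 * h * k))) := fun n hn => by
      have hn2 := Nat.pow_le_pow_left (Finset.mem_Icc.1 hn).2 2
      have hlt : x % 2 ^ (2 * (d + 2 * h * j)) + n ^ 2 < 2 ^ (2 * (d + 2 * h * j)) := by omega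
      have : (x + n ^ 2) / 2 ^ (2 * (d + 2 * h * j)) = x / 2 ^ (2 * (d + 2 * h * j)) := by
        conv_lhs => rw [← Nat.div_add_mod x (2 ^ (2 * (d + 2 * h * j))), add_assoc,
          Nat.mul_add_div (by positivity), Nat.div_eq_of_lt hlt, add_zero]
      rw [hpow, ← Nat.div_div_eq_div_mul, ← Nat.div_div_eq_div_mul, this]
    rw [Finset.sum_congr rfl hdiv, Finset.sum_const, Nat.card_Icc, Nat.add_sub_cancel,
      nsmul_eq_mul, ← mul_assoc, one_div, inv_mul_cancel₀ (by exact_mod_cast N.ne_zero), one_mul]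
  have hsmall : ∀ k ∈ Finset.range j, ‖(1 / ((N : ℕ) : ℂ)) * ∑ n ∈ Finset.Icc 1 (N : ℕ),
      (-1 : ℂ) ^ ((x + n ^ 2) / 2 ^ (2 * (d + 2 * h * k)))‖ ≤ 4 / 2 ^ h := by
    intro k hk
    -- The gap `2 * h` in the exponents makes `N ^ 2` large against the half period; `2 * h * K ≤ d`
    -- keeps `N` small against it.
    have hk1 : 2 * h * k + 2 * h ≤ 2 * h * j := by
      rw [← Nat.mul_succ]
      exact Nat.mul_le_mul_left _ (Finset.mem_range.1 hk)
    have hk2 : 2 * h * j ≤ 2 * h * K := Nat.mul_le_mul_left _ hj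
    rw [hN]
    exact norm_mean_neg_one_pow_sq_div_le (by omega) (by omega) x
  rw [hmean, ← Finset.sum_range_add_sum_Ico _ hj, Finset.sum_congr rfl hlarge, add_sub_cancel_right]
  refine (norm_sum_le_of_le _ hsmall).trans ?_
  rw [Finset.sum_const, Finset.card_range, nsmul_eq_mul]
  gcongr

/-! ### Independence of digits and rarity of jumps. -/

theorem sum_range_mul_of_periodic {A : Type*} [AddCommMonoid A] {φ : ℕ → A} {Q : ℕ}
    (hφ : ∀ x, φ (x + Q) = φ x) (q : ℕ) :
    ∑ x ∈ Finset.range (Q * q), φ x = q • ∑ x ∈ Finset.range Q, φ x := by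
  have hφ' : ∀ q x, φ (Q * q + x) = φ x := by
    intro q x
    induction q with
    | zero => simp
    | succ q ih => rw [Nat.mul_succ, add_right_comm, hφ, ih]
  induction q with
  | zero => simp
  | succ q ih => simp only [Nat.mul_succ, Finset.sum_range_add, ih, hφ', succ_nsmul]

theorem card_mod_add_ge_le {M t : ℕ} (q : ℕ) :
    ((Finset.range (M * q)).filter fun x => M ≤ x % M + t).card ≤ q * t := by
  rw [Finset.card_filter, sum_range_mul_of_periodic (by simp), smul_eq_mul]
  refine Nat.mul_le_mul_left _ ?_
  rw [← Finset.card_filter]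
  refine (Finset.card_le_card (t := Finset.Ico (M - t) M) fun x hx => ?_).trans ?_
  · rw [Finset.mem_filter, Finset.mem_range] at hx
    rw [Nat.mod_eq_of_lt hx.1] at hx
    rw [Finset.mem_Ico]
    omega
  · rw [Nat.card_Ico]
    omega

/-- Restriction to a subset of the coordinates has fibres of equal size. -/
theorem card_pow_mul_sum_comp {α β γ : Type*} [Fintype α] [Fintype β] [Fintype γ] [DecidableEq α]
    [DecidableEq β] {ι : α → β} (hι : Function.Injective ι) (Φ : (α → γ) → ℝ) :
    (Fintype.card γ : ℝ) ^ Fintype.card α * ∑ η : β → γ, Φ (η ∘ ι) =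
      (Fintype.card γ : ℝ) ^ Fintype.card β * ∑ ω, Φ ω := by
  classical
  let e : α ⊕ ↥(Set.range ι)ᶜ ≃ β :=
    ((Equiv.ofInjective ι hι).sumCongr (Equiv.refl _)).trans (Equiv.Set.sumCompl _)
  have he : ∀ a, e (Sum.inl a) = ι a := fun a => rfl
  have hcard : Fintype.card β = Fintype.card α + Fintype.card ↥(Set.range ι)ᶜ := by
    rw [← Fintype.card_sum, Fintype.card_congr e]
  let E : (β → γ) ≃ (α → γ) × (↥(Set.range ι)ᶜ → γ) :=
    (e.symm.arrowCongr (Equiv.refl γ)).trans (Equiv.sumArrowEquivProdArrow _ _ _)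
  have hE : ∀ η, (E η).1 = η ∘ ι := fun η => rfl
  simp only [← hE]
  rw [E.sum_comp fun p => Φ p.1, Fintype.sum_prod_type]
  simp only [Finset.sum_const, Finset.card_univ, Fintype.card_fun, nsmul_eq_mul, Nat.cast_pow,
    ← Finset.mul_sum]
  rw [hcard, pow_add, mul_assoc]

/-- Any `K` binary digits of a uniform `R`-digit number are uniformly distributed. -/
theorem two_pow_mul_sum_digits {R K : ℕ} {e : Fin K → ℕ} (he : Function.Injective e)
    (heR : ∀ k, e k < R) (Φ : (Fin K → Fin 2) → ℝ) :
    2 ^ K * ∑ x ∈ Finset.range (2 ^ R), Φ (fun k => ⟨x / 2 ^ e k % 2, Nat.mod_lt _ two_pos⟩) =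
      2 ^ R * ∑ ω, Φ ω := by
  have h := card_pow_mul_sum_comp (ι := fun k => (⟨e k, heR k⟩ : Fin R)) (γ := Fin 2)
    (fun k l hkl => he (by simpa using hkl)) Φ
  rw [← finFunctionFinEquiv.symm.sum_comp] at h
  simp only [Fintype.card_fin] at h
  rw [Finset.sum_range]
  exact_mod_cast h

/-- The binary digits of `x` at the positions `2 (d + 2 h k)`. -/
def spreadDigits (d h K x : ℕ) : Fin K → Fin 2 :=
  fun k => ⟨x / 2 ^ (2 * (d + 2 * h * k)) % 2, Nat.mod_lt _ two_pos⟩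

/-- The waves that survive the `i`-th average are the total minus the walk at time `i`; increments
of the averages are thus those of the walk up to sign. -/
theorem signWalk_spreadDigits_add {d h K i : ℕ} (x : ℕ) (hi : i ≤ K) :
    (signWalk (spreadDigits d h K x) i : ℂ) +
      ∑ k ∈ Finset.Ico i K, (-1) ^ (x / 2 ^ (2 * (d + 2 * h * k))) = waveSum d h K x := by
  rw [waveSum, ← Finset.sum_range_add_sum_Ico _ hi, signWalk]
  congr 1
  push_cast
  refine Finset.sum_congr rfl fun k hk => ?_
  have hk : k < K := (Finset.mem_range.1 hk).trans_le hi
  simp only [signStep, dif_pos hk, spreadDigits]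
  push_cast
  exact (neg_one_pow_eq_pow_mod_two _).symm

theorem abs_signWalk_le {K : ℕ} (ω : Fin K → Fin 2) (j : ℕ) : |signWalk ω j| ≤ j := by
  refine (Finset.abs_sum_le_sum_abs _ _).trans ?_
  refine (Finset.sum_le_card_nsmul _ _ 1 fun k _ => ?_).trans (by simp)
  unfold signStep
  split_ifs <;> simp

theorem waveSum_periodic {d h K R : ℕ} (hR : 2 * (d + 2 * h * K) ≤ R) (hh : 0 < h) (x : ℕ) :
    waveSum d h K (x + 2 ^ R) = waveSum d h K x := by
  refine Finset.sum_congr rfl fun k hk => ?_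
  have h1 : 2 * h * k + 2 * h ≤ 2 * h * K := by
    rw [← Nat.mul_succ]
    exact Nat.mul_le_mul_left _ (Finset.mem_range.1 hk)
  obtain ⟨l, hl⟩ : ∃ l, R = 2 * (d + 2 * h * k) + (l + 1) :=
    ⟨R - 2 * (d + 2 * h * k) - 1, by omega⟩
  rw [hl, pow_add, Nat.add_mul_div_left _ _ (by positivity), pow_add, pow_succ 2 l, pow_mul' _ _ 2,
    neg_one_sq, one_pow, mul_one]

theorem norm_waveSum {d h K : ℕ} (x : ℕ) :
    ‖waveSum d h K x‖ ^ 2 = signWalk (spreadDigits d h K x) K ^ 2 := by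
  rw [← signWalk_spreadDigits_add x le_rfl, Finset.Ico_self, Finset.sum_empty, add_zero,
    Complex.norm_real, Real.norm_eq_abs, sq_abs]

theorem two_pow_mul_sum_spreadDigits {d h K R : ℕ} (hR : 2 * (d + 2 * h * K) ≤ R) (hh : 0 < h)
    (Φ : (Fin K → Fin 2) → ℝ) :
    2 ^ K * ∑ x ∈ Finset.range (2 ^ R), Φ (spreadDigits d h K x) = 2 ^ R * ∑ ω, Φ ω := by
  refine two_pow_mul_sum_digits (e := fun k : Fin K => 2 * (d + 2 * h * k)) (fun k l hkl => ?_)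
    (fun k => ?_) Φ
  · have h1 : 2 * h * (k : ℕ) = 2 * h * l := by
      simp only at hkl
      omega
    exact Fin.ext (Nat.eq_of_mul_eq_mul_left (by omega) h1)
  · have h1 : 2 * h * (k : ℕ) + 2 * h ≤ 2 * h * K := by
      rw [← Nat.mul_succ]
      exact Nat.mul_le_mul_left _ k.2
    show 2 * (d + 2 * h * (k : ℕ)) < R
    omega

/-- The times at which the square waves are separated by the averages along squares. -/
def waveTime (d h j : ℕ) : ℕ+ := ⟨2 ^ (d + 2 * h * j - h), by positivity⟩

theorem strictMono_waveTime {d h : ℕ} (hh : 0 < h) (hd : h ≤ d) : StrictMono (waveTime d h) := by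
  refine strictMono_nat_of_lt_succ fun j => ?_
  rw [← PNat.coe_lt_coe]
  refine Nat.pow_lt_pow_right one_lt_two ?_
  rw [Nat.mul_succ]
  omega

/-- The integers close to a jump of one of the square waves. -/
def jumpSet (d h K R : ℕ) : Finset ℕ :=
  (Finset.range (K + 1)).biUnion fun j => (Finset.range (2 ^ R)).filter fun x =>
    2 ^ (2 * (d + 2 * h * j)) ≤ x % 2 ^ (2 * (d + 2 * h * j)) + (waveTime d h j : ℕ) ^ 2

theorem card_jumpSet_le {d h K R : ℕ} (hR : 2 * (d + 2 * h * K) ≤ R) (hd : h ≤ d) :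
    (jumpSet d h K R).card * 2 ^ h ≤ (K + 1) * 2 ^ R := by
  have hone : ∀ j ∈ Finset.range (K + 1), ((Finset.range (2 ^ R)).filter fun x =>
      2 ^ (2 * (d + 2 * h * j)) ≤ x % 2 ^ (2 * (d + 2 * h * j)) +
        (waveTime d h j : ℕ) ^ 2).card ≤ 2 ^ (R - h) := by
    intro j hj
    have h1 : 2 * h * j ≤ 2 * h * K :=
      Nat.mul_le_mul_left _ (Nat.lt_succ_iff.1 (Finset.mem_range.1 hj))
    obtain ⟨l, hl⟩ : ∃ l, R = 2 * (d + 2 * h * j) + l := Nat.exists_eq_add_of_le (by omega)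
    have := card_mod_add_ge_le (M := 2 ^ (2 * (d + 2 * h * j)))
      (t := (waveTime d h j : ℕ) ^ 2) (2 ^ l)
    rw [← pow_add, ← hl] at this
    refine this.trans ?_
    show 2 ^ l * (2 ^ (d + 2 * h * j - h)) ^ 2 ≤ _
    rw [← pow_mul, ← pow_add]
    exact Nat.pow_le_pow_right two_pos (by omega)
  have := Nat.mul_le_mul_right (2 ^ h) (Finset.card_biUnion_le_card_mul _ _ _ hone)
  rw [Finset.card_range, mul_assoc, ← pow_add, Nat.sub_add_cancel (by omega)] at this
  exact this

theorem norm_sub_sq_le {E : Type*} [NormedAddCommGroup E] {p q p' q' : E} {η D : ℝ} (hp : ‖p - p'‖ ≤ η)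
    (hq : ‖q - q'‖ ≤ η) (hD : ‖p' - q'‖ ≤ D) :
    ‖p' - q'‖ ^ 2 ≤ ‖p - q‖ ^ 2 + 4 * η * D := by
  have hη : 0 ≤ η := (norm_nonneg _).trans hp
  have hD0 : 0 ≤ D := (norm_nonneg _).trans hD
  have h1 : ‖p' - q'‖ ≤ ‖p - q‖ + 2 * η := by
    have : p' - q' = (p - q) + ((q - q') - (p - p')) := by abel
    rw [this]
    refine (norm_add_le _ _).trans (add_le_add le_rfl ((norm_sub_le _ _).trans (by linarith)))
  rcases le_total ‖p' - q'‖ ‖p - q‖ with h | h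
  · have := pow_le_pow_left₀ (norm_nonneg _) h 2
    nlinarith [mul_nonneg hη hD0]
  · nlinarith [norm_nonneg (p - q), norm_nonneg (p' - q')]

/-- Away from the jumps every average is within `4 * K / 2 ^ h` of its model, and walk increments
are at most `2 * K`, whence the error `32 * K ^ 2 / 2 ^ h` per squared increment. Near a jump the
trivial bound `(2 * K) ^ 2` is used. -/
theorem blockVar_signWalk_le {d h m n R x : ℕ} (hm : 0 < m) (hd : 2 * h * m ^ n ≤ d)
    (hx : x < 2 ^ R) :
    blockVar m n (signWalk (spreadDigits d h (m ^ n) x)) 0 ≤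
      blockVar m n (fun j => squareMean Nat.succ (waveSum d h (m ^ n)) (waveTime d h j) x) 0 +
        (m : ℝ) ^ n * (32 * ((m : ℝ) ^ n) ^ 2 / 2 ^ h +
          if x ∈ jumpSet d h (m ^ n) R then 4 * ((m : ℝ) ^ n) ^ 2 else 0) := by
  obtain ⟨K, hK⟩ : ∃ K, K = m ^ n := ⟨_, rfl⟩
  have hKc : (m : ℝ) ^ n = K := by rw [hK]; push_cast; rfl
  have hD : ∀ i ≤ K, ∀ j ≤ K, ‖signWalk (spreadDigits d h (m ^ n) x) i -
      signWalk (spreadDigits d h (m ^ n) x) j‖ ≤ 2 * K := by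
    intro i hi j hj
    have h1 := abs_signWalk_le (spreadDigits d h (m ^ n) x) i
    have h2 := abs_signWalk_le (spreadDigits d h (m ^ n) x) j
    have hi' : (i : ℝ) ≤ K := by exact_mod_cast hi
    have hj' : (j : ℝ) ≤ K := by exact_mod_cast hj
    refine (norm_sub_le _ _).trans ?_
    rw [Real.norm_eq_abs, Real.norm_eq_abs]
    linarith
  rw [hKc]
  have hδ : 0 ≤ 32 * (K : ℝ) ^ 2 / 2 ^ h +
      if x ∈ jumpSet d h (m ^ n) R then 4 * (K : ℝ) ^ 2 else 0 := by
    split_ifs <;> positivity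
  refine le_trans (blockVar_le_add hm hδ n _
    (fun j => squareMean Nat.succ (waveSum d h (m ^ n)) (waveTime d h j) x) 0 0
    fun i hi j hj => ?_) (by rw [hKc])
  rw [← hK] at hi hj
  simp only [zero_add]
  split_ifs with hjump
  · have h1 := pow_le_pow_left₀ (norm_nonneg _) (hD i hi j hj) 2
    have h2 : 0 ≤ 32 * (K : ℝ) ^ 2 / 2 ^ h := by positivity
    have h3 : 0 ≤ ‖squareMean Nat.succ (waveSum d h (m ^ n)) (waveTime d h i) x -
      squareMean Nat.succ (waveSum d h (m ^ n)) (waveTime d h j) x‖ ^ 2 := sq_nonneg _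
    nlinarith
  · have hgood : ∀ i ≤ K, ‖(waveSum d h (m ^ n) x -
        squareMean Nat.succ (waveSum d h (m ^ n)) (waveTime d h i) x) -
          (signWalk (spreadDigits d h (m ^ n) x) i : ℂ)‖ ≤ K * (4 / 2 ^ h) := by
      intro i hi
      have hxi : x % 2 ^ (2 * (d + 2 * h * i)) + (waveTime d h i : ℕ) ^ 2 <
          2 ^ (2 * (d + 2 * h * i)) := by
        by_contra! hcon
        refine hjump (Finset.mem_biUnion.2 ⟨i, ?_, Finset.mem_filter.2 ⟨?_, hcon⟩⟩)
        · exact Finset.mem_range.2 (by omega)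
        · exact Finset.mem_range.2 hx
      have h1 := norm_squareMean_waveSum_sub_le hd (hK ▸ hi) (N := waveTime d h i) rfl hxi
      rw [← signWalk_spreadDigits_add x (hK ▸ hi : i ≤ m ^ n)]
      rw [norm_sub_rev, ← hK] at h1
      rw [hK] at h1 ⊢
      refine le_trans (le_of_eq ?_) h1
      congr 1
      rw [add_sub_assoc, add_sub_cancel_left]
    have h1 := norm_sub_sq_le (D := 2 * K) (hgood i hi) (hgood j hj) (by
      rw [← Complex.ofReal_sub, Complex.norm_real]
      exact hD i hi j hj)
    rw [← Complex.ofReal_sub, Complex.norm_real, sub_sub_sub_cancel_left, norm_sub_rev _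
      (squareMean Nat.succ (waveSum d h (m ^ n)) (waveTime d h i) x)] at h1
    refine h1.trans (le_of_eq ?_)
    ring

/-! ### The periodic model. -/

/-- Finite model: on the cyclic group of order `2 ^ R`, the averages along squares have a
`2`-variation that is large in mean square. -/
theorem exists_periodic_blockVar (C : ℝ) : ∃ m n R₀ : ℕ, 0 < m ∧ ∀ R, R₀ ≤ R →
    ∃ (F : ℕ → ℂ) (N : ℕ → ℕ+), StrictMono N ∧ (∀ x, F (x + 2 ^ R) = F x) ∧
      0 < ∑ x ∈ Finset.range (2 ^ R), ‖F x‖ ^ 2 ∧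
      C * ∑ x ∈ Finset.range (2 ^ R), ‖F x‖ ^ 2 ≤
        ∑ x ∈ Finset.range (2 ^ R), blockVar m n (fun j => squareMean Nat.succ F (N j) x) 0 := by
  -- The extra 1 pays for the approximation error, which will be at most `2 ^ R`.
  obtain ⟨m, n, hm, hC⟩ := exists_le_meanBlockVar (C + 1)
  obtain ⟨K, hK⟩ : ∃ K, K = m ^ n := ⟨_, rfl⟩
  have hK0 : 0 < K := hK ▸ pow_pos hm n
  have hK1 : (1 : ℝ) ≤ K := by exact_mod_cast hK0
  have hKc : (m : ℝ) ^ n = K := by rw [hK]; push_cast; rfl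
  -- The two summands are the uniform error and the contribution of the jump set, summed over a
  -- period and divided by `2 ^ R / 2 ^ h`.
  obtain ⟨h, hh⟩ := exists_nat_ge (K * (32 * (K : ℝ) ^ 2) + (K + 1) * (K * (4 * (K : ℝ) ^ 2)))
  have hh0 : 0 < h := by
    have : (0 : ℝ) < h := lt_of_lt_of_le (by positivity) hh
    exact_mod_cast this
  have hh2 : K * (32 * (K : ℝ) ^ 2) + (K + 1) * (K * (4 * (K : ℝ) ^ 2)) ≤ 2 ^ h :=
    hh.trans (by exact_mod_cast Nat.lt_two_pow_self.le)
  refine ⟨m, n, 4 * (2 * h * K), hm, fun R hR => ?_⟩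
  -- The largest `d` for which all the waves have period dividing `2 ^ R`, with room for `K` gaps;
  -- the bound on `R` then gives `2 * h * K ≤ d`.
  obtain ⟨d, hd⟩ : ∃ d, d = (R - 4 * h * K) / 2 := ⟨_, rfl⟩
  have e1 : 4 * h * K = 2 * (2 * h * K) := by ring
  have hd1 : 2 * h * K ≤ d := by omega
  have hd2 : h ≤ d := by
    refine le_trans ?_ hd1
    rw [mul_comm 2 h, mul_assoc]
    exact Nat.le_mul_of_pos_right _ (by omega)
  have hd3 : 2 * (d + 2 * h * K) ≤ R := by omega
  have hnorm : ∑ x ∈ Finset.range (2 ^ R), ‖waveSum d h K x‖ ^ 2 = 2 ^ R * K := by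
    simp only [norm_waveSum]
    have := two_pow_mul_sum_spreadDigits hd3 hh0 (fun ω => signWalk ω K ^ 2)
    rw [sum_signWalk_sq, mul_comm (K : ℝ), mul_left_comm] at this
    exact mul_left_cancel₀ (by positivity) this
  have hwalk : (C + 1) * (2 ^ R * K) ≤ ∑ x ∈ Finset.range (2 ^ R),
      blockVar m n (signWalk (spreadDigits d h (m ^ n) x)) 0 := by
    have h1 := two_pow_mul_sum_spreadDigits (hK ▸ hd3) hh0 (fun ω => blockVar m n (signWalk ω) 0)
    rw [meanBlockVar, le_div_iff₀ (by positivity)] at hC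
    have h2 := mul_le_mul_of_nonneg_left hC (by positivity : (0 : ℝ) ≤ 2 ^ R)
    rw [← h1, hKc] at h2
    refine le_of_mul_le_mul_left (le_trans (le_of_eq ?_) h2) (by positivity : (0 : ℝ) < 2 ^ m ^ n)
    ring
  refine ⟨waveSum d h K, waveTime d h, strictMono_waveTime hh0 hd2, waveSum_periodic hd3 hh0,
    ?_, ?_⟩
  · rw [hnorm]
    positivity
  · have hle := hwalk.trans (Finset.sum_le_sum fun x hx =>
      blockVar_signWalk_le hm (hK ▸ hd1) (Finset.mem_range.1 hx))
    rw [Finset.sum_add_distrib, ← Finset.mul_sum, Finset.sum_add_distrib, Finset.sum_const,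
      Finset.card_range, nsmul_eq_mul, ← Finset.sum_filter, Finset.sum_const, nsmul_eq_mul, hKc,
      ← hK] at hle
    have hjump : (((Finset.range (2 ^ R)).filter (· ∈ jumpSet d h K R)).card : ℝ) * 2 ^ h ≤
        (K + 1) * 2 ^ R := by
      have h1 : ((Finset.range (2 ^ R)).filter (· ∈ jumpSet d h K R)).card ≤
          (jumpSet d h K R).card :=
        Finset.card_le_card fun x hx => (Finset.mem_filter.1 hx).2
      exact_mod_cast (Nat.mul_le_mul_right _ h1).trans (card_jumpSet_le hd3 hd2)
    have hloss : K * (((2 ^ R : ℕ) : ℝ) * (32 * (K : ℝ) ^ 2 / 2 ^ h) +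
        ((Finset.range (2 ^ R)).filter (· ∈ jumpSet d h K R)).card * (4 * (K : ℝ) ^ 2)) ≤
          2 ^ R := by
      refine le_of_mul_le_mul_right ?_ (by positivity : (0 : ℝ) < 2 ^ h)
      have h1 := mul_le_mul_of_nonneg_right hjump (by positivity : 0 ≤ K * (4 * (K : ℝ) ^ 2))
      have h2 := mul_le_mul_of_nonneg_left hh2 (by positivity : (0 : ℝ) ≤ 2 ^ R)
      have h3 : (32 * (K : ℝ) ^ 2 / 2 ^ h) * 2 ^ h = 32 * (K : ℝ) ^ 2 :=
        div_mul_cancel₀ _ (by positivity)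
      push_cast
      generalize (32 * (K : ℝ) ^ 2 / 2 ^ h) = w at h3 ⊢
      have h4 : K * (2 ^ R * w) * 2 ^ h = K * 2 ^ R * (32 * (K : ℝ) ^ 2) := by rw [← h3]; ring
      rw [mul_add, add_mul, h4]
      linarith
    rw [hnorm]
    have : (2 : ℝ) ^ R ≤ 2 ^ R * K := le_mul_of_one_le_right (by positivity) hK1
    linarith

/-! ### Transference to dynamical systems. -/

theorem sum_indicator_of_mem {X A : Type*} [AddCommMonoid A] {H i : ℕ} {B : ℕ → Set X}
    (hB : ∀ i < H, ∀ j < H, i ≠ j → Disjoint (B i) (B j)) (g : ℕ → A) (hi : i < H) {x : X}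
    (hx : x ∈ B i) : ∑ l ∈ Finset.range H, (B l).indicator (fun _ => g l) x = g i := by
  rw [Finset.sum_eq_single_of_mem i (Finset.mem_range.2 hi), Set.indicator_of_mem hx]
  exact fun l hl hli => Set.indicator_of_notMem
    (fun hxl => (hB l (Finset.mem_range.1 hl) i hi hli).le_bot ⟨hxl, hx⟩) _

theorem eLpNorm_two_eq_one {X : Type*} [MeasurableSpace X] {μ : Measure X} {f : X → ℂ}
    (h : ∫⁻ x, ‖f x‖ₑ ^ (2 : ℝ) ∂μ = 1) : eLpNorm f 2 μ = 1 := by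
  rw [eLpNorm_eq_lintegral_rpow_enorm_toReal two_ne_zero ENNReal.ofNat_ne_top, ENNReal.toReal_ofNat, h,
    ENNReal.one_rpow]

theorem ofReal_le_eLpNorm_two {X : Type*} [MeasurableSpace X] {μ : Measure X} {V : X → ℝ≥0∞}
    {C : ℝ} (hC : 0 ≤ C) (h : ENNReal.ofReal (C ^ 2) ≤ ∫⁻ x, V x ^ (2 : ℝ) ∂μ) :
    ENNReal.ofReal C ≤ eLpNorm V 2 μ := by
  rw [eLpNorm_eq_lintegral_rpow_enorm_toReal two_ne_zero ENNReal.ofNat_ne_top, ENNReal.toReal_ofNat,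
    one_div, ENNReal.le_rpow_inv_iff two_pos, ENNReal.ofReal_rpow_of_nonneg hC zero_le_two,
    Real.rpow_two]
  simpa only [enorm_eq_self] using h

theorem lintegral_sum_indicator {X : Type*} [MeasurableSpace X] {μ : Measure X} {H : ℕ}
    {B : ℕ → Set X} {β : ℝ} (hβ : 0 ≤ β) (hBm : ∀ i < H, MeasurableSet (B i))
    (hμ : ∀ i < H, μ (B i) = ENNReal.ofReal β) (g : ℕ → ℝ) (hg : ∀ i, 0 ≤ g i) :
    ∫⁻ x, ∑ i ∈ Finset.range H, (B i).indicator (fun _ => ENNReal.ofReal (g i)) x ∂μ =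
      ENNReal.ofReal (∑ i ∈ Finset.range H, g i * β) := by
  rw [lintegral_finsetSum _ fun i hi =>
    measurable_const.indicator (hBm i (Finset.mem_range.1 hi)),
    ENNReal.ofReal_sum_of_nonneg fun i _ => mul_nonneg (hg i) hβ]
  refine Finset.sum_congr rfl fun i hi => ?_
  have hi := Finset.mem_range.1 hi
  rw [lintegral_indicator_const (hBm i hi), hμ i hi, ENNReal.ofReal_mul (hg i)]

/-- Transference of a variation lower bound from the shift on the integers to a dynamical system
with a tower of sets of equal measure. -/
theorem exists_rVariation_ge_of_tower {X : Type*} [MeasurableSpace X] {μ : Measure X} {S : X → X}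
    {m n H H' : ℕ} (hm : 0 < m) {F : ℕ → ℂ} {N : ℕ → ℕ+} (hN : StrictMono N)
    {B : ℕ → Set X} {β C : ℝ} (hβ : 0 < β) (hC : 0 ≤ C) (hH : H' ≤ H)
    (hBm : ∀ i < H, MeasurableSet (B i)) (hB : ∀ i < H, ∀ j < H, i ≠ j → Disjoint (B i) (B j))
    (hμ : ∀ i < H, μ (B i) = ENNReal.ofReal β)
    (hS : ∀ i < H', ∀ x ∈ B i, ∀ j ≤ (N (m ^ n) : ℕ) ^ 2, ∃ l < H, S^[j] x ∈ B l ∧ F l = F (i + j))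
    (hF : 0 < ∑ i ∈ Finset.range H, ‖F i‖ ^ 2)
    (hV : C ^ 2 * ∑ i ∈ Finset.range H, ‖F i‖ ^ 2 ≤
      ∑ i ∈ Finset.range H', blockVar m n (fun j => squareMean Nat.succ F (N j) i) 0) :
    ∃ f : X → ℂ, MemLp f 2 μ ∧ eLpNorm f 2 μ = 1 ∧
      ENNReal.ofReal C ≤ eLpNorm (fun x => rVariation 2 fun N => squareMean S f N x) 2 μ := by
  set s := ∑ i ∈ Finset.range H, ‖F i‖ ^ 2 with hs
  -- Normalizes the function that equals `F i` on the `i`-th floor.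
  set c : ℝ := (√(s * β))⁻¹ with hc
  have hc2 : c ^ 2 * (s * β) = 1 := by
    rw [hc, inv_pow, Real.sq_sqrt (by positivity), inv_mul_cancel₀ (by positivity)]
  have hcn : ‖(c : ℂ)‖ ^ 2 = c ^ 2 := by
    rw [Complex.norm_real, Real.norm_eq_abs, sq_abs]
  set f : X → ℂ := fun x => ∑ i ∈ Finset.range H, (B i).indicator (fun _ => c * F i) x with hf
  have hf_mem : ∀ i < H, ∀ x ∈ B i, f x = c * F i := fun i hi x hx =>
    sum_indicator_of_mem hB (fun i => c * F i) hi hx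
  refine ⟨f, ?_, eLpNorm_two_eq_one ?_, ofReal_le_eLpNorm_two hC ?_⟩
  · refine memLp_finsetSum _ fun i hi => ?_
    have hi := Finset.mem_range.1 hi
    exact memLp_indicator_const 2 (hBm i hi) _ (Or.inr (by rw [hμ i hi]; exact ENNReal.ofReal_ne_top))
  · have h1 : ∀ x, ‖f x‖ₑ ^ (2 : ℝ) = ∑ i ∈ Finset.range H,
        (B i).indicator (fun _ => ENNReal.ofReal (c ^ 2 * ‖F i‖ ^ 2)) x := by
      intro x
      by_cases hx : ∃ i < H, x ∈ B i
      · obtain ⟨i, hi, hxi⟩ := hx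
        rw [sum_indicator_of_mem hB (fun i => ENNReal.ofReal (c ^ 2 * ‖F i‖ ^ 2)) hi hxi,
          hf_mem i hi x hxi, ← hcn, ← mul_pow, ← norm_mul, ENNReal.ofReal_pow (norm_nonneg _),
          ofReal_norm, ENNReal.rpow_two]
      · push Not at hx
        have h0 : f x = 0 := Finset.sum_eq_zero fun i hi =>
          Set.indicator_of_notMem (hx i (Finset.mem_range.1 hi)) _
        rw [h0, enorm_zero, ENNReal.zero_rpow_of_pos two_pos]
        exact (Finset.sum_eq_zero fun i hi =>
          Set.indicator_of_notMem (hx i (Finset.mem_range.1 hi)) _).symm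
    simp only [h1]
    rw [lintegral_sum_indicator hβ.le hBm hμ _ fun i => by positivity, ← Finset.sum_mul, ← Finset.mul_sum,
      ← hs, mul_assoc, hc2, ENNReal.ofReal_one]
  · set U : ℕ → ℝ := fun i => blockVar m n (fun j => squareMean Nat.succ F (N j) i) 0 with hU
    have hU0 : ∀ i, 0 ≤ U i := fun i => blockVar_nonneg _ _ _ _
    have h1 : ∀ x, ∑ i ∈ Finset.range H', (B i).indicator (fun _ => ENNReal.ofReal (c ^ 2 * U i)) x ≤
        (rVariation 2 fun N => squareMean S f N x) ^ (2 : ℝ) := by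
      intro x
      by_cases hx : ∃ i < H', x ∈ B i
      · obtain ⟨i, hi, hxi⟩ := hx
        rw [sum_indicator_of_mem (fun i hi j hj => hB i (hi.trans_le hH) j (hj.trans_le hH))
          (fun i => ENNReal.ofReal (c ^ 2 * U i)) hi hxi]
        refine le_trans (le_of_eq ?_) (ofReal_blockVar_le_rVariation_sq hm n _ hN 0)
        have hmean : ∀ j ≤ m ^ n, squareMean S f (N j) x = c * squareMean Nat.succ F (N j) i := by
          intro j hj
          simp only [squareMean]
          rw [mul_left_comm, Finset.mul_sum _ _ (c : ℂ)]
          congr 1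
          refine Finset.sum_congr rfl fun k hk => ?_
          have hk2 : k ^ 2 ≤ (N (m ^ n) : ℕ) ^ 2 := Nat.pow_le_pow_left
            ((Finset.mem_Icc.1 hk).2.trans (PNat.coe_le_coe _ _ |>.2 (hN.monotone hj))) 2
          obtain ⟨l, hl, hSl, hFl⟩ := hS i hi x hxi (k ^ 2) hk2
          rw [hf_mem l hl _ hSl, hFl, Nat.succ_iterate]
        rw [hU, ← hcn, ← blockVar_const_mul]
        congr 1
        refine blockVar_congr hm n _ _ 0 0 fun p hp q hq => ?_
        rw [zero_add, zero_add, hmean p hp, hmean q hq]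
      · push Not at hx
        rw [Finset.sum_eq_zero fun i hi =>
          Set.indicator_of_notMem (hx i (Finset.mem_range.1 hi)) _]
        exact bot_le
    refine le_trans ?_ (lintegral_mono h1)
    rw [lintegral_sum_indicator hβ.le (fun i hi => hBm i (hi.trans_le hH))
      (fun i hi => hμ i (hi.trans_le hH)) _ fun i => mul_nonneg (sq_nonneg c) (hU0 i),
      ← Finset.sum_mul, ← Finset.mul_sum]
    refine ENNReal.ofReal_le_ofReal ?_
    have h2 := mul_le_mul_of_nonneg_left hV (by positivity : 0 ≤ c ^ 2 * β)
    have h3 : c ^ 2 * β * (C ^ 2 * s) = C ^ 2 * (c ^ 2 * (s * β)) := by ring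
    rw [h3, hc2, mul_one] at h2
    linarith

/-- An aperiodic transformation has sets of positive measure with long disjoint orbits. -/
theorem IsAperiodic.exists_disjoint_iterates {X : Type*} [MeasurableSpace X] {μ : Measure X}
    [IsProbabilityMeasure μ] {T : X → X} (hT : MeasurePreserving T μ μ) (h : IsAperiodic T μ)
    (H : ℕ) : ∃ B, MeasurableSet B ∧ μ B ≠ 0 ∧ ∀ n, 0 < n → n ≤ H → ∀ x ∈ B, T^[n] x ∉ B := by
  induction H with
  | zero => exact ⟨Set.univ, MeasurableSet.univ, by simp, fun n h1 h2 => by omega⟩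
  | succ H ih =>
    obtain ⟨E, hE, hE0, hdisj⟩ := ih
    obtain ⟨F, hFE, hF, hF0⟩ := h (H + 1) H.succ_pos E hE hE0
    have hTn := hT.iterate (H + 1)
    -- Removing the points that return to `F` at time `H + 1` leaves positive measure: `F` and its
    -- preimage have equal finite measure, so if one difference were null, both would be, and `F`
    -- would be invariant up to a null set.
    refine ⟨F \ (T^[H + 1] ⁻¹' F), hF.diff (hTn.measurable hF), fun h0 => hF0 ?_, ?_⟩
    · rw [measure_symmDiff_eq hF.nullMeasurableSet (hTn.measurable hF).nullMeasurableSet, h0,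
        zero_add]
      have h1 := measure_sdiff_add_inter (μ := μ) F (hTn.measurable hF)
      have h2 := measure_sdiff_add_inter (μ := μ) (T^[H + 1] ⁻¹' F) hF
      rw [h0, zero_add] at h1
      rw [hTn.measure_preimage hF.nullMeasurableSet, Set.inter_comm, h1] at h2
      exact (ENNReal.add_right_inj (measure_ne_top μ F)).1 (by rw [add_comm, h2, add_zero])
    · rintro n hn hnH x ⟨hx1, hx2⟩ ⟨hy1, -⟩
      rcases Nat.lt_or_ge n (H + 1) with h | h
      · exact hdisj n hn (by omega) x (hFE hx1) (hFE hy1)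
      · obtain rfl : n = H + 1 := by omega
        exact hx2 hy1

/-- The rotation by `1 / 2 ^ R` permutes the arcs of length `1 / 2 ^ R` cyclically. As `F` has
period `2 ^ R`, orbits may wrap around and every floor is usable. -/
theorem exists_rVariation_ge_addCircle {C : ℝ} (hC : 0 < C) : ∃ R₀ : ℕ, ∀ R : ℕ, R₀ ≤ R →
    ∃ f : UnitAddCircle → ℂ, MemLp f 2 volume ∧ eLpNorm f 2 volume = 1 ∧
      ENNReal.ofReal C ≤ eLpNorm (fun x => rVariation 2 fun N =>
        squareMean (fun y => y + (((1 / 2 ^ R : ℝ)) : UnitAddCircle)) f N x) 2 volume := by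
  obtain ⟨m, n, R₀, hm, hR₀⟩ := exists_periodic_blockVar (C ^ 2)
  refine ⟨R₀, fun R hR => ?_⟩
  obtain ⟨F, N, hN, hF, hF0, hV⟩ := hR₀ R hR
  set Q : ℕ := 2 ^ R with hQ
  have hQ0 : 0 < Q := by positivity
  have hQr : (0 : ℝ) < Q := by exact_mod_cast hQ0
  have hQc : (2 : ℝ) ^ R = Q := by rw [hQ]; push_cast; rfl
  rw [hQc]
  let rep : UnitAddCircle → ℝ := fun x => (AddCircle.equivIco 1 0 x : ℝ)
  have hrep_coe : ∀ x, ((rep x : ℝ) : UnitAddCircle) = x := fun x => AddCircle.coe_equivIco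
  have hrep : ∀ z : ℝ, 0 ≤ z → z < 1 → rep (z : UnitAddCircle) = z := fun z h0 h1 =>
    congrArg Subtype.val (AddCircle.equivIco_coe_eq (p := (1 : ℝ)) (a := 0) (by simpa using ⟨h0, h1⟩))
  have hrep_meas : Measurable rep :=
    measurable_subtype_coe.comp (AddCircle.measurableEquivIco 1 0).measurable
  set B : ℕ → Set UnitAddCircle := fun i => rep ⁻¹' Set.Ico (i / Q : ℝ) ((i + 1) / Q) with hB
  refine exists_rVariation_ge_of_tower (H := Q) (H' := Q) (B := B) (β := 1 / Q) hm hN (by positivity)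
    hC.le le_rfl (fun i _ => hrep_meas measurableSet_Ico) ?_ ?_ ?_ hF0 hV
  · intro i _ j _ hij
    refine Set.disjoint_left.2 fun x hxi hxj => hij ?_
    simp only [hB, Set.mem_preimage, Set.mem_Ico, div_le_iff₀ hQr, lt_div_iff₀ hQr] at hxi hxj
    have h1 : (i : ℝ) < j + 1 := by linarith
    have h2 : (j : ℝ) < i + 1 := by linarith
    norm_cast at h1 h2
    omega
  · intro i hi
    have hi' : (i : ℝ) + 1 ≤ Q := by exact_mod_cast hi
    have hset : ((↑) : ℝ → UnitAddCircle) ⁻¹' B i ∩ Set.Ico 0 (0 + 1) =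
        Set.Ico (i / Q : ℝ) ((i + 1) / Q) := by
      ext z
      simp only [hB, Set.mem_inter_iff, Set.mem_preimage, zero_add]
      constructor
      · rintro ⟨h1, h2⟩
        rwa [hrep z h2.1 h2.2] at h1
      · intro h1
        have h2 : 0 ≤ z := le_trans (by positivity) h1.1
        have h3 : z < 1 := h1.2.trans_le ((div_le_one hQr).2 hi')
        exact ⟨by rwa [hrep z h2 h3], h2, h3⟩
    have hmeas : MeasurableSet (B i) := hrep_meas measurableSet_Ico
    have hmk := UnitAddCircle.measurePreserving_mk 0
    rw [← hmk.measure_preimage hmeas.nullMeasurableSet, ← restrict_Ico_eq_restrict_Ioc,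
      Measure.restrict_apply (hmk.measurable hmeas), hset, Real.volume_Ico]
    congr 1
    ring
  · intro i hi x hx j _
    refine ⟨(i + j) % Q, Nat.mod_lt _ hQ0, ?_, ?_⟩
    · simp only [hB, Set.mem_preimage, Set.mem_Ico, div_le_iff₀ hQr, lt_div_iff₀ hQr] at hx
      have hmod : (((i + j) % Q : ℕ) : ℝ) = i + j - Q * ((i + j) / Q : ℕ) := by
        rw [eq_sub_iff_add_eq]
        exact_mod_cast Nat.mod_add_div (i + j) Q
      have hlt : (((i + j) % Q : ℕ) : ℝ) + 1 ≤ Q := by exact_mod_cast Nat.mod_lt (i + j) hQ0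
      -- The representative of the rotated point in `[0, 1)`: the quotient `(i + j) / Q` counts the
      -- completed turns.
      set z : ℝ := rep x + j * (1 / Q) - ((i + j) / Q : ℕ) with hz
      have hzQ : z * Q = rep x * Q + j - Q * ((i + j) / Q : ℕ) := by
        rw [hz]
        field_simp
      have hz0 : (((i + j) % Q : ℕ) : ℝ) ≤ z * Q := by linarith [hx.1]
      have hz1 : z * Q < (((i + j) % Q : ℕ) : ℝ) + 1 := by linarith [hx.2]
      have hzx : (fun y => y + ((1 / Q : ℝ) : UnitAddCircle))^[j] x = (z : UnitAddCircle) := by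
        have hone : (((((i + j) / Q : ℕ) : ℝ)) : UnitAddCircle) = 0 := by
          rw [← nsmul_one, AddCircle.coe_nsmul, AddCircle.coe_period, smul_zero]
        rw [add_right_iterate, hz, AddCircle.coe_sub, AddCircle.coe_add, hone, hrep_coe, sub_zero,
          ← nsmul_eq_mul, AddCircle.coe_nsmul]
      rw [hzx]
      simp only [hB, Set.mem_preimage, Set.mem_Ico]
      rw [hrep z (nonneg_of_mul_nonneg_left (le_trans (by positivity) hz0) hQr)
        (lt_of_mul_lt_mul_right (by linarith) hQr.le), div_le_iff₀ hQr, lt_div_iff₀ hQr]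
      exact ⟨hz0, hz1⟩
    · exact (Function.Periodic.map_mod_nat hF _)

/-- Without wrap-around only the lower half of the tower is used as starting points, so that orbits
stay inside it. -/
theorem exists_rVariation_ge_of_isAperiodic {X : Type*} [MeasurableSpace X] (μ : Measure X)
    [IsProbabilityMeasure μ] (τ : X ≃ᵐ X) (hτ : MeasurePreserving τ μ μ) (h : IsAperiodic τ μ)
    {C : ℝ} (hC : 0 < C) : ∃ f : X → ℂ, MemLp f 2 μ ∧ eLpNorm f 2 μ = 1 ∧
      ENNReal.ofReal C ≤ eLpNorm (fun x => rVariation 2 fun N =>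
        squareMean τ.symm f N x) 2 μ := by
  -- The factor 2 compensates for discarding the upper half of the tower.
  obtain ⟨m, n, R, hm, hR⟩ := exists_periodic_blockVar (2 * C ^ 2)
  obtain ⟨F, N, hN, hF, hF0, hV⟩ := hR R le_rfl
  set Q : ℕ := 2 ^ R with hQ
  have hQ0 : 0 < Q := by positivity
  -- Each half consists of `p` full periods of `F` and is longer than the largest square used.
  set p : ℕ := (N (m ^ n) : ℕ) ^ 2 + 1 with hp
  have hpQ : (N (m ^ n) : ℕ) ^ 2 < Q * p := (Nat.lt_succ_self _).trans_le (Nat.le_mul_of_pos_left _ hQ0)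
  obtain ⟨A, hA, hA0, hdisj⟩ := h.exists_disjoint_iterates hτ (Q * (2 * p))
  have hiter : ∀ i j x, τ^[i + j] (τ.symm^[j] x) = τ^[i] x := fun i j x => by
    rw [Function.iterate_add_apply]
    congr 1
    exact (Function.LeftInverse.iterate τ.apply_symm_apply j) x
  have hsumF : ∑ i ∈ Finset.range (Q * (2 * p)), ‖F i‖ ^ 2 =
      2 * p * ∑ i ∈ Finset.range Q, ‖F i‖ ^ 2 := by
    rw [sum_range_mul_of_periodic (fun x => by rw [hF]), nsmul_eq_mul]
    push_cast
    rfl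
  have hp0 : (0 : ℝ) < p := by positivity
  refine exists_rVariation_ge_of_tower (n := n) (H := Q * (2 * p)) (H' := Q * p) (F := F)
    (B := fun i => τ^[i] ⁻¹' A) (β := (μ A).toReal) hm hN
    (ENNReal.toReal_pos hA0 (measure_ne_top _ _)) hC.le (Nat.mul_le_mul_left _ (by omega))
    (fun i _ => (τ.measurable.iterate i) hA) ?_ ?_ ?_ ?_ ?_
  · have key : ∀ i j, i < j → j < Q * (2 * p) → Disjoint (τ^[i] ⁻¹' A) (τ^[j] ⁻¹' A) := by
      intro i j hij hj
      refine Set.disjoint_left.2 fun x hxi hxj => ?_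
      refine hdisj (j - i) (by omega) (by omega) _ hxi ?_
      rw [← Function.iterate_add_apply, Nat.sub_add_cancel hij.le]
      exact hxj
    intro i hi j hj hij
    rcases hij.lt_or_gt with h | h
    · exact key i j h hj
    · exact (key j i h hi).symm
  · intro i _
    rw [ENNReal.ofReal_toReal (measure_ne_top _ _)]
    exact (hτ.iterate i).measure_preimage hA.nullMeasurableSet
  · intro i hi x hx j hj
    refine ⟨i + j, ?_, ?_, rfl⟩
    · have : Q * (2 * p) = Q * p + Q * p := by ring
      omega
    · show τ^[i + j] (τ.symm^[j] x) ∈ A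
      rw [hiter]
      exact hx
  · rw [hsumF]
    positivity
  · rw [hsumF, sum_range_mul_of_periodic, nsmul_eq_mul]
    · have := mul_le_mul_of_nonneg_left hV hp0.le
      linarith
    · intro x
      have : ∀ N, squareMean Nat.succ F N (x + Q) = squareMean Nat.succ F N x := fun N => by
        simp only [squareMean, Nat.succ_iterate, add_right_comm x Q, hF]
      simp only [this]

theorem mainTheorem3 :
    (∀ C : ℝ, 0 < C → ∃ R₀ : ℕ, ∀ R : ℕ, R₀ ≤ R →
      ∃ f : UnitAddCircle → ℂ, MemLp f 2 volume ∧ eLpNorm f 2 volume = 1 ∧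
        ENNReal.ofReal C ≤ eLpNorm (fun x => rVariation 2 fun N =>
          squareMean (fun y => y + (((1 / 2 ^ R : ℝ)) : UnitAddCircle)) f N x) 2 volume) ∧
    (∀ (X : Type*) [MeasurableSpace X] (μ : Measure X) [IsProbabilityMeasure μ] (τ : X ≃ᵐ X),
      MeasurePreserving τ μ μ → IsAperiodic τ μ →
      ∀ C : ℝ, 0 < C →
        ∃ f : X → ℂ, MemLp f 2 μ ∧ eLpNorm f 2 μ = 1 ∧
          ENNReal.ofReal C ≤ eLpNorm (fun x => rVariation 2 fun N =>
            squareMean τ.symm f N x) 2 μ) :=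
  ⟨fun _ hC => exists_rVariation_ge_addCircle hC,
    fun _ _ μ _ τ hτ h _ hC => exists_rVariation_ge_of_isAperiodic μ τ hτ h hC⟩
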